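/- Let $G=(V,E)$ be a finite undirected (multi)graph with unit edge costs, let $(s_1,t_1),\dots,(s_r,t_r)$ be $r\ge 1$ source–sink pairs with $s_i\ne t_i$, and let $k\ge 2$ be an integer. Consider the linear program $$\text{(P)}\quad \min \sum_e x_e\ \text{ s.t. } \sum_{e\in P}(x_e+y^i_e)\ge 1\ \ \forall i,\ \forall\, s_i\text{-}t_i\text{ path }P;\quad \sum_e y^i_e\le k-1\ \ \forall i;\quad x,y\ge 0,$$ let $(x,\{y^i\})$ be an optimal solution and $\mathrm{OPT}=\sum_e x_e$ its value. Write $\Lambda(r)=\ln r\,\ln\ln r$ for $r\ge 3$ and $\Lambda(r)=1$ for $r\le 2$. *The algorithm $k$-MCAlg with parameter $\gamma>1$.* Subdivide every edge $e$ of $G$ into a path $e_0,e_1,\dots,e_r$; put the value $x_e$ on $e_0$ (an "$x$-edge") and $y^i_e$ on $e_i$, all other values being $0$. In the subdivided graph, for each $i$ let $\ell^i$ be the shortest-path metric for the edge lengths $x_f+y^i_f$. Let $\beta=\mathrm{OPT}/r$ and, for a node set $S$, let $E(S)$ be the set of edges with both ends in $S$, let $\mathcal V^x(S)=\beta+\sum_{f\in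 E(S)}x_f$, and for $A\subseteq S$ let $\delta^S(A)$ be the set of edges between $A$ and $S\setminus A$. For $\rho\ge 0$ let $B=B^S_i(\rho)=\{v\in S:\ell^i(s_i,v)\le\rho\}$; let $\mathcal V(\rho)=\beta+\sum_{uv}\ell^i(u,v)+\sum_{uw}(\rho-\ell^i(s_i,u))$ and $\overline{\mathcal V}(\rho)=\beta+\sum_{vw}\ell^i(v,w)+\sum_{uw}(\ell^i(s_i,w)-\rho)$, where all sums are over $x$-edges: $uv$ over those inside $B$, $vw$ (in $\overline{\mathcal V}$) over those inside $S\setminus B$, and $uw$ over those with $u\in B$, $w\in S\setminus B$. Call $\rho\in[0,1)$ *good* for $(S,i)$ if $$|\delta^S(B^S_i(\rho))|\le \tfrac{2\gamma}{(\sqrt\gamma-1)^2}\,W\ln\!\Big(\tfrac{e\,\mathcal V^x(S)}{W}\Big)\ln\ln(e(r+1))\quad\text{for both } W=\mathcal V(\rho)\text{ and }W=\overline{\mathcal V}(\rho).$$ A call $(U,\mathcal T)$ starts with $S=U$, $Z=\emptyset$. While some pair of $\mathcal T$ with both terminals in $S$ is at least $\gamma(k-1)$-edge-connected in $(S,E(S))$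 (i.e. has at least $\gamma(k-1)$ pairwise edge-disjoint paths there), pick any such pair $i$ and any good radius $\rho$ for $(S,i)$; let $A=B^S_i(\rho)$ if this set contains at most $|\mathcal T|/2$ pairs of $\mathcal T$, and $A=S\setminus B^S_i(\rho)$ otherwise; add $\delta^S(A)$ to $Z$ and replace $S$ by $S\setminus A$. Then, for each set $A$ so obtained, call the algorithm recursively on $A$ and the pairs of $\mathcal T$ contained in $A$, add the results to $Z$, and return $Z$. The initial call is on all nodes of the subdivided graph and all $r$ pairs, and the output is the set of edges of $G$ that have a part in the returned set. **Theorem.** There is an absolute constant $C>0$ such that the following holds for all such instances and optimal solutions. 1. For every $\gamma>1$, the algorithm is well defined (a good radius exists for every $S$ and every pair $i$ with both terminals in $S$ that is at least $\gamma(k-1)$-edge-connected in $(S,E(S))$) and, however its choices are made, it terminates; every edge set $Z$ that it returns is such that every pair $s_i,t_i$ is less than $\gamma(k-1)$-edge-connected in $(V,E\setminus Z)$, and $$|Z|\le C\,\frac{\gamma}{(\sqrt\gamma-1)^2}\,\Lambda(r)\cdot \mathrm{OPT}.$$ 2. In particular, for $\gamma=\frac{k}{k-1}$ every returned set $Z$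 is a feasible solution of $k$-route multicut (for each $i$ there are at most $k-1$ edge-disjoint $s_i$-$t_i$ paths in $(V,E\setminus Z)$) and $|Z|\le C\,(k-1)^2\,\Lambda(r)\cdot\mathrm{OPT}$. -/

import Mathlib

open scoped ENNReal

noncomputable section

/-- An undirected multigraph with vertex type `V` and edge type `E`. The edge `e`
joins `left e` and `right e`; which end is called left is immaterial. -/
structure MultiGraph (V E : Type*) where
  left : E → V
  right : E → V

namespace MultiGraph

variable {V E : Type*} (G : MultiGraph V E)

/-- `e` is an edge between `u` and `v` (in either order). -/
def Joins (e : E) (u v : V) : Prop :=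
  (G.left e = u ∧ G.right e = v) ∨ (G.left e = v ∧ G.right e = u)

inductive Walk : V → V → Type _
  | nil (u : V) : Walk u u
  | cons {u v w : V} (e : E) (h : G.Joins e u v) (p : Walk v w) : Walk u w

namespace Walk

variable {G}

def edges : {u v : V} → G.Walk u v → List E
  | _, _, nil _ => []
  | _, _, cons e _ p => e :: p.edges

def support : {u v : V} → G.Walk u v → List V
  | _, _, nil u => [u]
  | u, _, cons _ _ p => u :: p.support

/-- A simple path: no vertex is repeated. -/
def IsPath {u v : V} (p : G.Walk u v) : Prop := p.support.Nodup

/-- Total length of a walk for the edge lengths `l`. -/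
def length {u v : V} (l : E → ℝ) (p : G.Walk u v) : ℝ := (p.edges.map l).sum

end Walk

/-- There are `m` pairwise edge-disjoint `u`-`v` paths all of whose edges lie in `F`. -/
def HasDisjointPaths (F : Set E) (u v : V) (m : ℕ) : Prop :=
  ∃ P : Fin m → G.Walk u v,
    (∀ j, (P j).IsPath ∧ ∀ e ∈ (P j).edges, e ∈ F) ∧
    ∀ j j', j ≠ j' → List.Disjoint (P j).edges (P j').edges

/-- `u` and `v` are at least `q`-edge-connected (`q` real) in the graph with edge set `F`. -/
def AtLeastConnected (F : Set E) (u v : V) (q : ℝ) : Prop :=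
  ∃ m : ℕ, q ≤ m ∧ G.HasDisjointPaths F u v m

/-- The shortest-path metric for edge lengths `l ≥ 0`; it is `∞` between different components. -/
def pathDist (l : E → ℝ) (u v : V) : ℝ≥0∞ :=
  ⨅ p : G.Walk u v, ENNReal.ofReal (p.length l)

/-- `E(S)`: the edges with both ends in `S`. -/
def inside (S : Finset V) : Set E := {e | G.left e ∈ S ∧ G.right e ∈ S}

open scoped Classical in
/-- `δ^S(A)`: the edges with one end in `A` and the other in `S \ A`. -/
def boundary [Fintype E] (S A : Finset V) : Finset E :=
  Finset.univ.filter fun e => ∃ u ∈ A, ∃ v ∈ S \ A, G.Joins e u v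

open scoped Classical in
/-- `B^S_ℓ(z, ρ)`. -/
def ball (l : V → V → ℝ≥0∞) (S : Finset V) (z : V) (ρ : ℝ) : Finset V :=
  S.filter fun v => l z v ≤ ENNReal.ofReal ρ

open scoped Classical in
/-- `𝒱^{S,F}_ℓ(β; z, ρ)` for unit costs: the second and third sums run over the edges of `F` from
the ball to its complement in `S`, according to which end is in the ball. -/
def volume (l : V → V → ℝ≥0∞) (F : Finset E) (S : Finset V) (β : ℝ) (z : V) (ρ : ℝ) : ℝ :=
  let B := ball l S z ρ
  β + ∑ e ∈ F with G.left e ∈ B ∧ G.right e ∈ B, (l (G.left e) (G.right e)).toReal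
    + ∑ e ∈ F with G.left e ∈ B ∧ G.right e ∈ S \ B, (ρ - (l z (G.left e)).toReal)
    + ∑ e ∈ F with G.right e ∈ B ∧ G.left e ∈ S \ B, (ρ - (l z (G.right e)).toReal)

open scoped Classical in
/-- The complementary volume, of the part of `S` outside the ball, for unit costs. -/
def coVolume (l : V → V → ℝ≥0∞) (F : Finset E) (S : Finset V) (β : ℝ) (z : V) (ρ : ℝ) : ℝ :=
  let B := ball l S z ρ
  β + ∑ e ∈ F with G.left e ∈ S \ B ∧ G.right e ∈ S \ B, (l (G.left e) (G.right e)).toReal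
    + ∑ e ∈ F with G.left e ∈ B ∧ G.right e ∈ S \ B, ((l z (G.right e)).toReal - ρ)
    + ∑ e ∈ F with G.right e ∈ B ∧ G.left e ∈ S \ B, ((l z (G.left e)).toReal - ρ)

/-- The `m`-th node (`0 ≤ m ≤ r + 1`) on the path that replaces `e` when every edge is subdivided
into `r + 1` edges. -/
def subNode (r : ℕ) (e : E) (m : ℕ) : V ⊕ (E × Fin r) :=
  if m = 0 then Sum.inl (G.left e)
  else if h : m - 1 < r then Sum.inr (e, ⟨m - 1, h⟩)
  else Sum.inl (G.right e)

/-- Every edge `e` is subdivided into the path `(e,0), (e,1), …, (e,r)`. -/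
def subdivide (r : ℕ) : MultiGraph (V ⊕ (E × Fin r)) (E × Fin (r + 1)) where
  left f := G.subNode r f.1 (f.2 : ℕ)
  right f := G.subNode r f.1 ((f.2 : ℕ) + 1)

end MultiGraph

/-- A unit-cost multicut instance with `r` source-sink pairs. -/
structure MulticutInstance (V E : Type*) (r : ℕ) where
  graph : MultiGraph V E
  s : Fin r → V
  t : Fin r → V
  ne : ∀ i, s i ≠ t i

namespace MulticutInstance

variable {V E : Type*} {r : ℕ} (I : MulticutInstance V E r)

/-- Feasibility for `k`-route multicut: after removing `Z`, any family of edge-disjoint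
`s i`-`t i` paths has at most `k - 1` members. -/
def IsFeasible (k : ℕ) (Z : Finset E) : Prop :=
  ∀ i m, I.graph.HasDisjointPaths {e | e ∉ Z} (I.s i) (I.t i) m → m < k

/-- `(x, y)` is a feasible point of the linear relaxation of `k`-route multicut. -/
def LPFeasible [Fintype E] (k : ℕ) (x : E → ℝ) (y : Fin r → E → ℝ) : Prop :=
  (∀ i (P : I.graph.Walk (I.s i) (I.t i)), P.IsPath → 1 ≤ P.length fun e => x e + y i e) ∧
  (∀ i, ∑ e, y i e ≤ (k : ℝ) - 1) ∧
  (∀ e, 0 ≤ x e) ∧ ∀ i e, 0 ≤ y i e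

/-- `(x, y)` is an optimal solution of the linear relaxation with unit costs. -/
def LPOptimal [Fintype E] (k : ℕ) (x : E → ℝ) (y : Fin r → E → ℝ) : Prop :=
  I.LPFeasible k x y ∧ ∀ x' y', I.LPFeasible k x' y' → ∑ e, x e ≤ ∑ e, x' e

end MulticutInstance

/-- The data on which the rounding algorithm works: a graph with source-sink pairs, a fractional
solution `(x, y)`, and the set `F` of `x`-edges. -/
structure RoundingData (V E : Type*) (r : ℕ) where
  graph : MultiGraph V E
  s : Fin r → V
  t : Fin r → V
  x : E → ℝ
  y : Fin r → E → ℝ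
  F : Finset E

open scoped Classical in
/-- The subdivided graph: `(e,0)` is an `x`-edge and carries `x e`, and `(e,i+1)` is a `y i`-edge
and carries `y i e`. -/
def MulticutInstance.subdivide {V E : Type*} [Fintype E] {r : ℕ} (I : MulticutInstance V E r)
    (x : E → ℝ) (y : Fin r → E → ℝ) :
    RoundingData (V ⊕ (E × Fin r)) (E × Fin (r + 1)) r where
  graph := I.graph.subdivide r
  s i := Sum.inl (I.s i)
  t i := Sum.inl (I.t i)
  x f := if f.2 = 0 then x f.1 else 0
  y i f := if f.2 = i.succ then y i f.1 else 0
  F := Finset.univ.filter fun f => f.2 = 0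

namespace RoundingData

variable {V E : Type*} [Fintype E] {r : ℕ} (D : RoundingData V E r)

/-- The value of the fractional solution. -/
def opt : ℝ := ∑ e, D.x e

def β : ℝ := D.opt / r

/-- The metric `ℓ^i` of commodity `i`. -/
def dist (i : Fin r) : V → V → ℝ≥0∞ := D.graph.pathDist fun e => D.x e + D.y i e

open scoped Classical in
/-- `𝒱^x(S)`. -/
def xVolume (S : Finset V) : ℝ := D.β + ∑ e with e ∈ D.graph.inside S, D.x e

/-- `B^S_i(s_i, ρ)`. -/
def ball (S : Finset V) (i : Fin r) (ρ : ℝ) : Finset V :=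
  MultiGraph.ball (D.dist i) S (D.s i) ρ

/-- The radii `ρ ∈ [0,1)` that may be used for commodity `i` and the current node set `S`: the cost
of the boundary of the ball is bounded through the volumes on both sides. -/
def GoodRadius (γ : ℝ) (S : Finset V) (i : Fin r) (ρ : ℝ) : Prop :=
  let cut : ℝ := (D.graph.boundary S (D.ball S i ρ)).card
  let vol := D.graph.volume (D.dist i) D.F S D.β (D.s i) ρ
  let covol := D.graph.coVolume (D.dist i) D.F S D.β (D.s i) ρ
  let K := 2 * γ / (√γ - 1) ^ 2
  let L := Real.log (Real.log (Real.exp 1 * (r + 1)))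
  0 ≤ ρ ∧ ρ < 1 ∧
  cut ≤ K * vol * Real.log (Real.exp 1 * D.xVolume S / vol) * L ∧
  cut ≤ K * covol * Real.log (Real.exp 1 * D.xVolume S / covol) * L

open scoped Classical in
/-- The pairs of `T` with both terminals in `X`. -/
def pairsIn (T : Finset (Fin r)) (X : Finset V) : Finset (Fin r) :=
  T.filter fun i => D.s i ∈ X ∧ D.t i ∈ X

open scoped Classical in
/-- `𝒯'`: the pairs of `T` that are at least `γ(k-1)`-edge-connected in `(S, E(S))`. -/
def active (γ : ℝ) (k : ℕ) (T : Finset (Fin r)) (S : Finset V) : Finset (Fin r) :=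
  (D.pairsIn T S).filter fun i =>
    D.graph.AtLeastConnected (D.graph.inside S) (D.s i) (D.t i) (γ * ((k : ℝ) - 1))

open scoped Classical in
/-- The region carved out of `S`: the ball if it contains at most half of the pairs of `T`, and
otherwise its complement in `S`. -/
def region (T : Finset (Fin r)) (S : Finset V) (i : Fin r) (ρ : ℝ) : Finset V :=
  if 2 * (D.pairsIn T (D.ball S i ρ)).card ≤ T.card then D.ball S i ρ else S \ D.ball S i ρ

end RoundingData

/-- A resolution of the two choices that the algorithm leaves open: which active pair is processed
next when the pairs of the call are `T` and the current node set is `S`, and which radius is used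
for the pair `i` and the set `S`. (No set `S` with an active pair occurs twice in an execution, so
every execution comes from such a resolution.) -/
structure Choices (V : Type*) (r : ℕ) where
  pick : Finset (Fin r) → Finset V → Fin r
  radius : Finset V → Fin r → ℝ

namespace RoundingData

variable {V E : Type*} [Fintype E] {r : ℕ} (D : RoundingData V E r)

/-- The choices respect the rules of the algorithm: the pair picked is active, and the radius used
for an active pair is a good one. -/
def ValidChoices (γ : ℝ) (k : ℕ) (χ : Choices V r) : Prop :=
  (∀ T S, (D.active γ k T S).Nonempty → χ.pick T S ∈ D.active γ k T S) ∧
  ∀ S, ∀ i ∈ D.active γ k Finset.univ S, D.GoodRadius γ S i (χ.radius S i)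

/-- The region carved out of the current set `S` in a call with pairs `T`. -/
def nextRegion (χ : Choices V r) (T : Finset (Fin r)) (S : Finset V) : Finset V :=
  D.region T S (χ.pick T S) (χ.radius S (χ.pick T S))

open scoped Classical in
/-- The while loop of a call with pairs `T`: `D.Carve γ k χ T S 𝒮 Z` says that, started from the
current node set `S`, the loop ends, having carved out the regions `𝒮` (in this order) and having
collected the set `Z` of all their boundary edges. -/
inductive Carve (γ : ℝ) (k : ℕ) (χ : Choices V r) (T : Finset (Fin r)) :
    Finset V → List (Finset V) → Finset E → Prop
  | done (S : Finset V) (h : D.active γ k T S = ∅) : Carve γ k χ T S [] ∅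
  | step (S : Finset V) (𝒮 : List (Finset V)) (Z : Finset E)
      (h : (D.active γ k T S).Nonempty)
      (next : Carve γ k χ T (S \ D.nextRegion χ T S) 𝒮 Z) :
      Carve γ k χ T S (D.nextRegion χ T S :: 𝒮) (D.graph.boundary S (D.nextRegion χ T S) ∪ Z)

open scoped Classical in
/-- `D.Returns γ k χ U T Z`: the recursive call with node set `U` and pairs `T` terminates and
returns `Z`. After the while loop every carved region `A` is treated recursively, with the pairs
inside `A`, and `R A` is what this recursive call returns. -/
inductive Returns (γ : ℝ) (k : ℕ) (χ : Choices V r) :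
    Finset V → Finset (Fin r) → Finset E → Prop
  | call (U : Finset V) (T : Finset (Fin r)) (𝒮 : List (Finset V)) (Z : Finset E)
      (R : Finset V → Finset E)
      (loop : D.Carve γ k χ T U 𝒮 Z)
      (recurse : ∀ A ∈ 𝒮, Returns γ k χ A (D.pairsIn T A) (R A)) :
      Returns γ k χ U T (Z ∪ 𝒮.toFinset.biUnion R)

end RoundingData

open scoped Classical in
/-- The algorithm `k`-MCAlg with parameter `γ`, run on the fractional solution `(x, y)` with choices
`χ`, returns the edge set `Z` of the given graph: it is called on the whole subdivided graph and all
pairs, and `Z` consists of the edges one of whose parts is in the set that this call returns. -/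
def MulticutInstance.AlgReturns {V E : Type*} [Fintype V] [Fintype E] {r : ℕ}
    (I : MulticutInstance V E r) (k : ℕ) (γ : ℝ) (x : E → ℝ) (y : Fin r → E → ℝ)
    (χ : Choices (V ⊕ (E × Fin r)) r) (Z : Finset E) : Prop :=
  ∃ Z', (I.subdivide x y).Returns γ k χ Finset.univ Finset.univ Z' ∧ Z = Z'.image Prod.fst

/-- `ln r · ln ln r`, replaced by `1` for `r ≤ 2`, where `ln ln r` is undefined or negative. -/
def logFactor (r : ℕ) : ℝ := if r ≤ 2 then 1 else Real.log r * Real.log (Real.log r)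

end

/-! The proof is region growing with a double-logarithmic charge. For a current set `S` and a
commodity `i`, let v(ρ) and w(ρ) be the volumes of the x-edges on the two sides of the ball, u(ρ)
the ball volume of the remaining edges (those carrying only y), and X = 𝒱^x(S). Away from finitely
many radii, v' = -w' is the number of x-edges cut and u' the number of other edges cut. The function
u/(√γ(k-1)) - ln ln(eX/v)/a + ln ln(eX/w)/a is monotone, and for a suitable a it grows by at most 1
on [0,1], because u ≤ k-1, v and w lie in [β, X], and X ≤ (r+1)β. So at some radius the expression
for its derivative is at most 1, and hence so is each of its three nonnegative terms
(`Admissible.exists_radius`). There at most √γ(k-1) edges outside the x-edges are cut, while the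
ball separates a pair that is γ(k-1)-connected. The x-edges therefore make up a constant fraction of
the cut, and the radius is good (`Admissible.exists_goodRadius`). If β = 0 there is no active pair
at all (`Admissible.β_pos`).

The cost is controlled by the potential `costBound`. A cut is at most a multiple of W ln(eX/W),
where W is at most β plus the weight that leaves the current set. The β-part is paid by the pair
just separated. In the rest, the term 1 + ln X - ln W' is paid by two decreases: ln X - ln W'
telescopes along the recursion, and the 1 is covered because the region has at most half of the
pairs (`region_cost_le`). At the root the potential is O(OPT ln r), and the factor ln ln(e(r+1))
comes from the good radius.

For correctness, edge-disjoint paths that avoid the returned set cannot cross a carved boundary, so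
they are confined to ever smaller regions until the pair would be active when a loop has stopped
(`Admissible.exists_region_of_carve`). Subdivision loses nothing: disjoint paths lift to it, and a
potential carries the LP path constraints over (`LPFeasible.one_le_dist`). -/

open scoped ENNReal

noncomputable section

/-! ### Walks, shortest-path distances and cuts -/

namespace MultiGraph

variable {V E : Type*} {G : MultiGraph V E}

theorem Joins.symm {e : E} {u v : V} (h : G.Joins e u v) : G.Joins e v u := Or.symm h

theorem joins_left_right (G : MultiGraph V E) (e : E) : G.Joins e (G.left e) (G.right e) :=
  Or.inl ⟨rfl, rfl⟩

namespace Walk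

theorem length_cons {u v w : V} (l : E → ℝ) (e : E) (h : G.Joins e u v) (p : G.Walk v w) :
    (cons e h p).length l = l e + p.length l := by
  simp [length, edges]

theorem length_nil (l : E → ℝ) (u : V) : (nil (G := G) u).length l = 0 := by
  simp [length, edges]

theorem length_nonneg {l : E → ℝ} (hl : ∀ e, 0 ≤ l e) {u v : V} (p : G.Walk u v) :
    0 ≤ p.length l :=
  List.sum_nonneg (by simpa using fun e _ => hl e)

theorem exists_append (l : E → ℝ) {u v w : V} (p : G.Walk u v) (q : G.Walk v w) :
    ∃ p' : G.Walk u w, p'.length l = p.length l + q.length l := by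
  induction p with
  | nil u => exact ⟨q, by simp [length_nil]⟩
  | cons e h p ih =>
    obtain ⟨p', hp'⟩ := ih q
    exact ⟨cons e h p', by rw [length_cons, length_cons, hp', add_assoc]⟩

theorem exists_reverse (l : E → ℝ) {u v : V} (p : G.Walk u v) :
    ∃ p' : G.Walk v u, p'.length l = p.length l := by
  induction p with
  | nil u => exact ⟨nil u, rfl⟩
  | @cons a b c e h p ih =>
    obtain ⟨p', hp'⟩ := ih
    obtain ⟨q, hq⟩ := exists_append l p' (cons e h.symm (nil a))
    exact ⟨q, by rw [hq, length_cons, length_cons, length_nil, hp']; ring⟩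

/-- The part of a walk after a visited vertex. -/
theorem exists_suffix {u v w : V} (p : G.Walk u w) (hv : v ∈ p.support) :
    ∃ q : G.Walk v w, q.edges.Sublist p.edges ∧ q.support.Sublist p.support := by
  induction p with
  | nil u =>
    obtain rfl : v = u := by simpa [support] using hv
    exact ⟨nil v, List.Sublist.refl _, List.Sublist.refl _⟩
  | @cons a b c e h p ih =>
    rcases List.mem_cons.1 hv with rfl | hv
    · exact ⟨cons e h p, List.Sublist.refl _, List.Sublist.refl _⟩
    · obtain ⟨q, hq, hq'⟩ := ih hv
      exact ⟨q, hq.cons _, hq'.cons _⟩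

/-- Every walk can be shortened to a path. -/
theorem exists_isPath {u v : V} (p : G.Walk u v) :
    ∃ q : G.Walk u v, q.IsPath ∧ q.edges.Sublist p.edges := by
  induction p with
  | nil u => exact ⟨nil u, by simp [IsPath, support], List.Sublist.refl _⟩
  | @cons a b c e h p ih =>
    obtain ⟨q, hq, hs⟩ := ih
    by_cases ha : a ∈ q.support
    · obtain ⟨q', h1, h2⟩ := exists_suffix q ha
      exact ⟨q', h2.nodup hq, (h1.trans hs).cons _⟩
    · exact ⟨cons e h q, List.nodup_cons.2 ⟨ha, hq⟩, hs.cons_cons e⟩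

/-- The increments of `f` telescope along the walk. This is weak duality: a potential certifies a
lower bound on all walk lengths at once. -/
theorem sub_le_length {l : E → ℝ} {f : V → ℝ}
    (hf : ∀ e u v, G.Joins e u v → f v - f u ≤ l e) {u v : V} (p : G.Walk u v) :
    f v - f u ≤ p.length l := by
  induction p with
  | nil u => simp [length_nil]
  | @cons a b c e h p ih =>
    rw [length_cons]
    linarith [hf e a b h]

/-- A walk that leaves `X` has an edge that leaves `X`. -/
theorem exists_leaving_edge {X : Set V} {u v : V} (p : G.Walk u v) (hu : u ∈ X) (hv : v ∉ X) :
    ∃ e ∈ p.edges, ∃ a ∈ X, ∃ b, b ∉ X ∧ G.Joins e a b := by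
  induction p with
  | nil u => exact absurd hu hv
  | @cons a b c e h p ih =>
    by_cases hb : b ∈ X
    · obtain ⟨f, hf, H⟩ := ih hb hv
      exact ⟨f, List.mem_cons_of_mem _ hf, H⟩
    · exact ⟨e, List.mem_cons_self, a, hu, b, hb, h⟩

/-- A walk none of whose edges leaves `X` and that starts in `X` stays inside `X`. -/
theorem forall_inside {X : Finset V} {u v : V} (p : G.Walk u v) (hu : u ∈ X)
    (hp : ∀ e ∈ p.edges, ∀ a ∈ X, ∀ b, G.Joins e a b → b ∈ X) :
    v ∈ X ∧ ∀ e ∈ p.edges, e ∈ G.inside X := by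
  induction p with
  | nil u => exact ⟨hu, by simp [edges]⟩
  | @cons a b c e h p ih =>
    have hb : b ∈ X := hp e List.mem_cons_self a hu b h
    obtain ⟨h1, h2⟩ := ih hb fun f hf => hp f (List.mem_cons_of_mem _ hf)
    refine ⟨h1, fun f hf => ?_⟩
    rcases List.mem_cons.1 hf with rfl | hf
    · rcases h with ⟨rfl, rfl⟩ | ⟨rfl, rfl⟩
      exacts [⟨hu, hb⟩, ⟨hb, hu⟩]
    · exact h2 f hf

end Walk

theorem mem_inside_iff_of_joins {e : E} {u v : V} (h : G.Joins e u v) (S : Finset V) :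
    e ∈ G.inside S ↔ u ∈ S ∧ v ∈ S := by
  rcases h with ⟨rfl, rfl⟩ | ⟨rfl, rfl⟩
  · rfl
  · exact and_comm

theorem pathDist_self (l : E → ℝ) (u : V) : G.pathDist l u u = 0 :=
  le_antisymm (iInf_le_of_le (Walk.nil u) (by simp [Walk.length_nil])) bot_le

theorem pathDist_comm (l : E → ℝ) (u v : V) : G.pathDist l u v = G.pathDist l v u := by
  have key : ∀ u v : V, G.pathDist l u v ≤ G.pathDist l v u := fun u v =>
    le_iInf fun p => by
      obtain ⟨q, hq⟩ := p.exists_reverse l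
      exact iInf_le_of_le q (by rw [hq])
  exact le_antisymm (key u v) (key v u)

theorem pathDist_triangle {l : E → ℝ} (hl : ∀ e, 0 ≤ l e) (u v w : V) :
    G.pathDist l u w ≤ G.pathDist l u v + G.pathDist l v w := by
  refine ENNReal.le_iInf_add_iInf fun p q => ?_
  obtain ⟨p', hp'⟩ := p.exists_append l q
  refine iInf_le_of_le p' ?_
  rw [hp', ENNReal.ofReal_add (p.length_nonneg hl) (q.length_nonneg hl)]

theorem pathDist_le_of_joins (l : E → ℝ) {e : E} {u v : V} (h : G.Joins e u v) :
    G.pathDist l u v ≤ ENNReal.ofReal (l e) :=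
  iInf_le_of_le (Walk.cons e h (Walk.nil v)) (by simp [Walk.length_cons, Walk.length_nil])

variable [Fintype E]

theorem mem_boundary {S A : Finset V} {e : E} :
    e ∈ G.boundary S A ↔ ∃ u ∈ A, ∃ v ∈ S, v ∉ A ∧ G.Joins e u v := by
  classical
  simp [boundary, and_assoc]

theorem boundary_sdiff [DecidableEq V] {S A : Finset V} (hA : A ⊆ S) :
    G.boundary S (S \ A) = G.boundary S A := by
  ext e
  simp only [mem_boundary, Finset.mem_sdiff]
  constructor
  · rintro ⟨u, ⟨hu, hu'⟩, v, hv, hv', h⟩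
    exact ⟨v, by tauto, u, hu, hu', h.symm⟩
  · rintro ⟨u, hu, v, hv, hv', h⟩
    exact ⟨v, ⟨hv, hv'⟩, u, hA hu, by tauto, h.symm⟩

/-- Edge-disjoint paths in `(S, E(S))` between the two sides of a cut use different cut edges. -/
theorem HasDisjointPaths.le_card_boundary {S A : Finset V} {u v : V} {m : ℕ}
    (h : G.HasDisjointPaths (G.inside S) u v m) (hu : u ∈ A) (hv : v ∉ A) :
    m ≤ (G.boundary S A).card := by
  obtain ⟨P, hP, hd⟩ := h
  have key : ∀ j, ∃ e ∈ (P j).edges, e ∈ G.boundary S A := fun j => by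
    obtain ⟨e, he, a, ha, b, hb, hj⟩ := (P j).exists_leaving_edge (X := (A : Set V)) hu hv
    refine ⟨e, he, mem_boundary.2 ⟨a, ha, b, ?_, hb, hj⟩⟩
    exact ((mem_inside_iff_of_joins hj S).1 ((hP j).2 e he)).2
  choose c hc hc' using key
  have hinj : Function.Injective c := fun j j' hjj => by
    by_contra hne
    exact hd j j' hne (hc j) (hjj ▸ hc j')
  simpa using Finset.card_le_card_of_injOn c (s := Finset.univ) (fun j _ => hc' j) hinj.injOn

end MultiGraph

/-! ### Averaging over the radius -/

/-- A monotone function that grows by at most `1` on `[0,1]` has somewhere derivative at most `1`. -/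
theorem MonotoneOn.exists_deriv_le_one {H h : ℝ → ℝ} {N : Set ℝ} (hN : N.Countable)
    (hH : MonotoneOn H (Set.Icc 0 1)) (h1 : H 1 - H 0 ≤ 1)
    (hd : ∀ ρ ∈ Set.Ioo (0 : ℝ) 1, ρ ∉ N → HasDerivAt H (h ρ) ρ) :
    ∃ ρ ∈ Set.Ioo (0 : ℝ) 1, h ρ ≤ 1 := by
  by_contra! hcon
  rw [← Set.uIcc_of_le zero_le_one] at hH
  have hint := hH.intervalIntegrable_deriv
  -- `H` may jump upwards, so the integral of its derivative is only bounded by the total increase.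
  -- This is the direction needed.
  have hmem := hH.intervalIntegral_deriv_mem_uIcc
  rw [Set.uIcc_of_le (sub_nonneg.2 (hH (by simp) (by simp) zero_le_one))] at hmem
  have hae : ∀ᵐ ρ ∂(MeasureTheory.volume.restrict (Set.Ioc (0 : ℝ) 1)), (1 : ℝ) < deriv H ρ := by
    rw [MeasureTheory.ae_restrict_iff' measurableSet_Ioc]
    have h0 : ∀ᵐ ρ : ℝ, ρ ∉ N ∪ {1} :=
      MeasureTheory.compl_mem_ae_iff.2 ((hN.union (Set.countable_singleton 1)).measure_zero _)
    filter_upwards [h0] with ρ hρ hρ'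
    have hρ1 : ρ ∈ Set.Ioo (0 : ℝ) 1 :=
      ⟨hρ'.1, lt_of_le_of_ne hρ'.2 fun h => hρ (Or.inr h)⟩
    rw [(hd ρ hρ1 fun h => hρ (Or.inl h)).deriv]
    exact hcon ρ hρ1
  have hlt := intervalIntegral.integral_lt_integral_of_ae_le_of_measure_setOfPred_lt_ne_zero
    (f := fun _ => (1 : ℝ)) zero_le_one intervalIntegrable_const hint (hae.mono fun _ h => h.le)
    (by
      intro h
      have h2 : ∀ᵐ ρ ∂(MeasureTheory.volume.restrict (Set.Ioc (0 : ℝ) 1)), False := by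
        filter_upwards [hae, MeasureTheory.compl_mem_ae_iff.2 h] with ρ a b using b a
      simpa using MeasureTheory.ae_iff.1 h2)
  rw [intervalIntegral.integral_const] at hlt
  simp at hlt
  linarith [hmem.2]

/-! ### Volumes of balls as functions of the radius -/

namespace MultiGraph

variable {V E : Type*} (G : MultiGraph V E)

theorem mem_ball {l : V → V → ℝ≥0∞} {S : Finset V} {z v : V} {ρ : ℝ} :
    v ∈ ball l S z ρ ↔ v ∈ S ∧ l z v ≤ ENNReal.ofReal ρ := by
  classical
  simp [ball]

theorem ball_subset (l : V → V → ℝ≥0∞) (S : Finset V) (z : V) (ρ : ℝ) : ball l S z ρ ⊆ S :=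
  fun _ hv => (mem_ball.1 hv).1

open scoped Classical in
/-- The contribution of the edge `e` to `volume`. -/
def edgeVolume (l : V → V → ℝ≥0∞) (S : Finset V) (z : V) (ρ : ℝ) (e : E) : ℝ :=
  let B := ball l S z ρ
  (if G.left e ∈ B ∧ G.right e ∈ B then (l (G.left e) (G.right e)).toReal else 0)
    + (if G.left e ∈ B ∧ G.right e ∈ S \ B then ρ - (l z (G.left e)).toReal else 0)
    + (if G.right e ∈ B ∧ G.left e ∈ S \ B then ρ - (l z (G.right e)).toReal else 0)

open scoped Classical in
/-- The contribution of the edge `e` to `coVolume`. -/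
def edgeCoVolume (l : V → V → ℝ≥0∞) (S : Finset V) (z : V) (ρ : ℝ) (e : E) : ℝ :=
  let B := ball l S z ρ
  (if G.left e ∈ S \ B ∧ G.right e ∈ S \ B then (l (G.left e) (G.right e)).toReal else 0)
    + (if G.left e ∈ B ∧ G.right e ∈ S \ B then (l z (G.right e)).toReal - ρ else 0)
    + (if G.right e ∈ B ∧ G.left e ∈ S \ B then (l z (G.left e)).toReal - ρ else 0)

theorem volume_eq (l : V → V → ℝ≥0∞) (F : Finset E) (S : Finset V) (β : ℝ) (z : V) (ρ : ℝ) :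
    G.volume l F S β z ρ = β + ∑ e ∈ F, G.edgeVolume l S z ρ e := by
  classical
  simp only [volume, edgeVolume, Finset.sum_filter, Finset.sum_add_distrib, add_assoc]

theorem coVolume_eq (l : V → V → ℝ≥0∞) (F : Finset E) (S : Finset V) (β : ℝ) (z : V) (ρ : ℝ) :
    G.coVolume l F S β z ρ = β + ∑ e ∈ F, G.edgeCoVolume l S z ρ e := by
  classical
  simp only [coVolume, edgeCoVolume, Finset.sum_filter, Finset.sum_add_distrib, add_assoc]

variable {G} {len : E → ℝ}

/-- The ends of an edge are either both at infinite distance from `z`, or at finite distances that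
differ by at most the length of the edge. -/
theorem pathDist_ends (hlen : ∀ e, 0 ≤ len e) (z : V) (e : E) :
    (G.pathDist len z (G.left e) = ⊤ ∧ G.pathDist len z (G.right e) = ⊤) ∨
    ∃ a b d : ℝ, 0 ≤ a ∧ 0 ≤ b ∧ 0 ≤ d ∧ d ≤ len e ∧ a ≤ b + d ∧ b ≤ a + d ∧
      G.pathDist len z (G.left e) = ENNReal.ofReal a ∧
      G.pathDist len z (G.right e) = ENNReal.ofReal b ∧
      G.pathDist len (G.left e) (G.right e) = ENNReal.ofReal d := by
  have hd := pathDist_le_of_joins len (G.joins_left_right e)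
  have hdt : G.pathDist len (G.left e) (G.right e) ≠ ⊤ := ne_top_of_le_ne_top (by simp) hd
  have h1 := pathDist_triangle (G := G) hlen z (G.left e) (G.right e)
  have h2 := pathDist_triangle (G := G) hlen z (G.right e) (G.left e)
  rw [pathDist_comm len (G.right e)] at h2
  generalize G.pathDist len z (G.left e) = A at *
  generalize G.pathDist len z (G.right e) = B at *
  generalize G.pathDist len (G.left e) (G.right e) = D at *
  lift D to NNReal using hdt
  by_cases hA : A = ⊤
  · left
    refine ⟨hA, ?_⟩
    by_contra hB
    lift B to NNReal using hB
    rw [hA, ← ENNReal.coe_add] at h2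
    simp at h2
  right
  lift A to NNReal using hA
  have hB : B ≠ ⊤ := ne_top_of_le_ne_top (by simp) h1
  lift B to NNReal using hB
  refine ⟨A, B, D, A.2, B.2, D.2, ?_, ?_, ?_, by simp, by simp, by simp⟩
  · rw [← ENNReal.ofReal_coe_nnreal, ENNReal.ofReal_le_ofReal_iff (hlen e)] at hd
    exact hd
  · exact_mod_cast h2
  · exact_mod_cast h1

/-- For an edge inside `S` with ends at distances a ≤ b from `z` and d apart, the contribution is 0
before a, ρ - a on [a, b), and d from b on. The triangle inequality b - a ≤ d makes the jump at b
upward. The dual lemma for `edgeCoVolume` runs through d, b - ρ and 0. -/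
theorem edgeVolume_mono (hlen : ∀ e, 0 ≤ len e) (S : Finset V) (z : V) (e : E) {ρ ρ' : ℝ}
    (h0 : 0 ≤ ρ) (h : ρ ≤ ρ') :
    G.edgeVolume (G.pathDist len) S z ρ e ≤ G.edgeVolume (G.pathDist len) S z ρ' e := by
  classical
  by_cases hS : G.left e ∈ S ∧ G.right e ∈ S
  swap
  · have : ¬ (G.left e ∈ S) ∨ ¬ (G.right e ∈ S) := by tauto
    rcases this with h | h <;> simp [edgeVolume, mem_ball, h]
  obtain ⟨hL, hR⟩ := hS
  rcases pathDist_ends (G := G) hlen z e with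
    ⟨hA, hB⟩ | ⟨a, b, d, ha, hb, hd, hde, h1, h2, hA, hB, hD⟩
  · simp [edgeVolume, mem_ball, hA, hB]
  · simp only [edgeVolume, mem_ball, Finset.mem_sdiff, hA, hB, hD, hL, hR, true_and,
      ENNReal.ofReal_le_ofReal_iff h0, ENNReal.ofReal_le_ofReal_iff (h0.trans h),
      ENNReal.toReal_ofReal, ha, hb, hd]
    split_ifs <;> first | (exfalso; grind) | linarith

theorem edgeCoVolume_anti (hlen : ∀ e, 0 ≤ len e) (S : Finset V) (z : V) (e : E) {ρ ρ' : ℝ}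
    (h0 : 0 ≤ ρ) (h : ρ ≤ ρ') :
    G.edgeCoVolume (G.pathDist len) S z ρ' e ≤ G.edgeCoVolume (G.pathDist len) S z ρ e := by
  classical
  by_cases hS : G.left e ∈ S ∧ G.right e ∈ S
  swap
  · have : ¬ (G.left e ∈ S) ∨ ¬ (G.right e ∈ S) := by tauto
    rcases this with h | h <;> simp [edgeCoVolume, mem_ball, h]
  obtain ⟨hL, hR⟩ := hS
  rcases pathDist_ends (G := G) hlen z e with
    ⟨hA, hB⟩ | ⟨a, b, d, ha, hb, hd, hde, h1, h2, hA, hB, hD⟩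
  · simp [edgeCoVolume, mem_ball, hA, hB]
  · simp only [edgeCoVolume, mem_ball, Finset.mem_sdiff, hA, hB, hD, hL, hR, true_and,
      ENNReal.ofReal_le_ofReal_iff h0, ENNReal.ofReal_le_ofReal_iff (h0.trans h),
      ENNReal.toReal_ofReal, ha, hb, hd]
    split_ifs <;> first | (exfalso; grind) | linarith

open scoped Classical in
-- Only edges inside `S` that touch the ball contribute, each at most its length. The bound is
-- written as a difference so that, summed over edges, it becomes the weight lost when the ball is
-- removed from `S`, cut edges included.
theorem edgeVolume_mem_Icc (hlen : ∀ e, 0 ≤ len e) (S : Finset V) (z : V) (e : E) {ρ : ℝ}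
    (h0 : 0 ≤ ρ) :
    0 ≤ G.edgeVolume (G.pathDist len) S z ρ e ∧ G.edgeVolume (G.pathDist len) S z ρ e ≤
      (if e ∈ G.inside S then len e else 0) -
        if e ∈ G.inside (S \ ball (G.pathDist len) S z ρ) then len e else 0 := by
  by_cases hS : G.left e ∈ S ∧ G.right e ∈ S
  swap
  · have : ¬ (G.left e ∈ S) ∨ ¬ (G.right e ∈ S) := by tauto
    rcases this with h | h <;> simp [edgeVolume, mem_ball, inside, h]
  obtain ⟨hL, hR⟩ := hS
  have he := hlen e
  rcases pathDist_ends (G := G) hlen z e with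
    ⟨hA, hB⟩ | ⟨a, b, d, ha, hb, hd, hde, h1, h2, hA, hB, hD⟩
  · simp [edgeVolume, mem_ball, inside, hA, hB, hL, hR]
  · simp only [edgeVolume, mem_ball, Finset.mem_sdiff, inside, Set.mem_ofPred_eq, hA, hB, hD, hL, hR,
      true_and, ENNReal.ofReal_le_ofReal_iff h0, ENNReal.toReal_ofReal, ha, hb, hd]
    constructor <;> split_ifs <;> first | (exfalso; grind) | linarith

open scoped Classical in
theorem edgeCoVolume_mem_Icc (hlen : ∀ e, 0 ≤ len e) (S : Finset V) (z : V) (e : E) {ρ : ℝ}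
    (h0 : 0 ≤ ρ) :
    0 ≤ G.edgeCoVolume (G.pathDist len) S z ρ e ∧ G.edgeCoVolume (G.pathDist len) S z ρ e ≤
      (if e ∈ G.inside S then len e else 0) -
        if e ∈ G.inside (ball (G.pathDist len) S z ρ) then len e else 0 := by
  by_cases hS : G.left e ∈ S ∧ G.right e ∈ S
  swap
  · have : ¬ (G.left e ∈ S) ∨ ¬ (G.right e ∈ S) := by tauto
    rcases this with h | h <;> simp [edgeCoVolume, mem_ball, inside, h]
  obtain ⟨hL, hR⟩ := hS
  have he := hlen e
  have hd' := ENNReal.toReal_mono (by simp) (pathDist_le_of_joins len (G.joins_left_right e))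
  rw [ENNReal.toReal_ofReal he] at hd'
  rcases pathDist_ends (G := G) hlen z e with
    ⟨hA, hB⟩ | ⟨a, b, d, ha, hb, hd, hde, h1, h2, hA, hB, hD⟩
  · simp [edgeCoVolume, mem_ball, inside, hA, hB, hL, hR, hd']
  · simp only [edgeCoVolume, mem_ball, Finset.mem_sdiff, inside, Set.mem_ofPred_eq, hA, hB, hD, hL,
      hR, true_and, ENNReal.ofReal_le_ofReal_iff h0, ENNReal.toReal_ofReal, ha, hb, hd]
    constructor <;> split_ifs <;> first | (exfalso; grind) | linarith

theorem volume_monotoneOn (hlen : ∀ e, 0 ≤ len e) (F : Finset E) (S : Finset V) (β : ℝ) (z : V) :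
    MonotoneOn (G.volume (G.pathDist len) F S β z) (Set.Icc 0 1) := fun ρ hρ ρ' _ h => by
  rw [volume_eq, volume_eq]
  gcongr with e
  exact edgeVolume_mono hlen S z e hρ.1 h

theorem coVolume_antitoneOn (hlen : ∀ e, 0 ≤ len e) (F : Finset E) (S : Finset V) (β : ℝ) (z : V) :
    AntitoneOn (G.coVolume (G.pathDist len) F S β z) (Set.Icc 0 1) := fun ρ hρ ρ' _ h => by
  rw [coVolume_eq, coVolume_eq]
  gcongr with e
  exact edgeCoVolume_anti hlen S z e hρ.1 h

theorem le_volume (hlen : ∀ e, 0 ≤ len e) (F : Finset E) (S : Finset V) (β : ℝ) (z : V) {ρ : ℝ}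
    (h0 : 0 ≤ ρ) : β ≤ G.volume (G.pathDist len) F S β z ρ := by
  rw [volume_eq]
  exact le_add_of_nonneg_right (Finset.sum_nonneg fun e _ => (edgeVolume_mem_Icc hlen S z e h0).1)

theorem le_coVolume (hlen : ∀ e, 0 ≤ len e) (F : Finset E) (S : Finset V) (β : ℝ) (z : V) {ρ : ℝ}
    (h0 : 0 ≤ ρ) : β ≤ G.coVolume (G.pathDist len) F S β z ρ := by
  rw [coVolume_eq]
  exact le_add_of_nonneg_right (Finset.sum_nonneg fun e _ => (edgeCoVolume_mem_Icc hlen S z e h0).1)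

open scoped Classical in
theorem volume_le (hlen : ∀ e, 0 ≤ len e) (F : Finset E) (S : Finset V) (β : ℝ) (z : V) {ρ : ℝ}
    (h0 : 0 ≤ ρ) : G.volume (G.pathDist len) F S β z ρ ≤
      β + (∑ e ∈ F with e ∈ G.inside S, len e -
        ∑ e ∈ F with e ∈ G.inside (S \ ball (G.pathDist len) S z ρ), len e) := by
  rw [volume_eq, Finset.sum_filter, Finset.sum_filter, ← Finset.sum_sub_distrib]
  gcongr with e
  exact (edgeVolume_mem_Icc hlen S z e h0).2

open scoped Classical in
theorem coVolume_le (hlen : ∀ e, 0 ≤ len e) (F : Finset E) (S : Finset V) (β : ℝ) (z : V) {ρ : ℝ}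
    (h0 : 0 ≤ ρ) : G.coVolume (G.pathDist len) F S β z ρ ≤
      β + (∑ e ∈ F with e ∈ G.inside S, len e -
        ∑ e ∈ F with e ∈ G.inside (ball (G.pathDist len) S z ρ), len e) := by
  rw [coVolume_eq, Finset.sum_filter, Finset.sum_filter, ← Finset.sum_sub_distrib]
  gcongr with e
  exact (edgeCoVolume_mem_Icc hlen S z e h0).2

/-- Away from the finitely many distances from `z`, the ball is locally constant in the radius. -/
theorem eventually_ball_eq (l : V → V → ℝ≥0∞) (S : Finset V) (z : V) {ρ : ℝ} (h0 : 0 < ρ)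
    (hρ : ρ ∉ (fun v => (l z v).toReal) '' (S : Set V)) :
    ∀ᶠ ρ' in nhds ρ, ball l S z ρ' = ball l S z ρ := by
  have key : ∀ v ∈ S, ∀ᶠ ρ' in nhds ρ,
      (l z v ≤ ENNReal.ofReal ρ' ↔ l z v ≤ ENNReal.ofReal ρ) := fun v hv => by
    by_cases hT : l z v = ⊤
    · simp [hT]
    have hne : (l z v).toReal ≠ ρ := fun h => hρ ⟨v, hv, h⟩
    rcases hne.lt_or_gt with h | h
    · filter_upwards [eventually_gt_nhds h] with ρ' h'
      exact iff_of_true (ENNReal.le_ofReal_iff_toReal_le hT (ENNReal.toReal_nonneg.trans h'.le)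
        |>.2 h'.le) (ENNReal.le_ofReal_iff_toReal_le hT h0.le |>.2 h.le)
    · filter_upwards [eventually_lt_nhds h, eventually_gt_nhds h0] with ρ' h' h''
      rw [ENNReal.le_ofReal_iff_toReal_le hT h''.le, ENNReal.le_ofReal_iff_toReal_le hT h0.le]
      exact iff_of_false h'.not_ge h.not_ge
  filter_upwards [(Filter.eventually_all_finset S).2 key] with ρ' h
  ext v
  simp only [mem_ball]
  exact and_congr_right fun hv => h v hv

variable [Fintype E]

open scoped Classical in
theorem card_boundary_inter (S B F : Finset _) :
    ((F.filter fun e => e ∈ G.boundary S B).card : ℝ) =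
      (F.filter fun e => G.left e ∈ B ∧ G.right e ∈ S \ B).card +
      (F.filter fun e => G.right e ∈ B ∧ G.left e ∈ S \ B).card := by
  rw [← Nat.cast_add, ← Finset.card_union_of_disjoint, ← Finset.filter_or]
  · congr 2
    ext e
    simp only [Finset.mem_filter, mem_boundary, Joins, Finset.mem_sdiff]
    refine and_congr_right fun _ => ⟨?_, ?_⟩
    · rintro ⟨u, hu, v, hv, hv', ⟨rfl, rfl⟩ | ⟨rfl, rfl⟩⟩
      exacts [Or.inl ⟨hu, hv, hv'⟩, Or.inr ⟨hu, hv, hv'⟩]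
    · rintro (⟨hu, hv, hv'⟩ | ⟨hu, hv, hv'⟩)
      exacts [⟨_, hu, _, hv, hv', Or.inl ⟨rfl, rfl⟩⟩, ⟨_, hu, _, hv, hv', Or.inr ⟨rfl, rfl⟩⟩]
  · rw [Finset.disjoint_filter]
    rintro e - ⟨h1, h2⟩ ⟨h3, h4⟩
    exact (Finset.mem_sdiff.1 h2).2 h3

open scoped Classical in
-- Between consecutive distances the ball is constant, so only the cut edges of `F` vary with the
-- radius, each with slope 1.
theorem hasDerivAt_volume (l : V → V → ℝ≥0∞) (F : Finset E) (S : Finset V) (β : ℝ) (z : V) {ρ : ℝ}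
    (h0 : 0 < ρ) (hρ : ρ ∉ (fun v => (l z v).toReal) '' (S : Set V)) :
    HasDerivAt (G.volume l F S β z)
      ((F.filter fun e => e ∈ G.boundary S (ball l S z ρ)).card : ℝ) ρ := by
  have hd : ∀ (F' : Finset E) (c : E → ℝ), HasDerivAt (fun ρ' : ℝ => ∑ e ∈ F', (ρ' - c e))
      (F'.card : ℝ) ρ := fun F' c => by
    have := HasDerivAt.fun_sum (u := F') (A := fun e (ρ' : ℝ) => ρ' - c e) (A' := fun _ => (1 : ℝ))
      (x := ρ) fun e _ => (hasDerivAt_id' ρ).sub_const _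
    simpa using this
  have key := (((hasDerivAt_const ρ (β + ∑ e ∈ F with
    G.left e ∈ ball l S z ρ ∧ G.right e ∈ ball l S z ρ, (l (G.left e) (G.right e)).toReal)).add
    (hd (F.filter fun e => G.left e ∈ ball l S z ρ ∧ G.right e ∈ S \ ball l S z ρ)
      fun e => (l z (G.left e)).toReal)).add
    (hd (F.filter fun e => G.right e ∈ ball l S z ρ ∧ G.left e ∈ S \ ball l S z ρ)
      fun e => (l z (G.right e)).toReal))
  rw [card_boundary_inter]
  rw [zero_add] at key
  refine key.congr_of_eventuallyEq ?_
  filter_upwards [eventually_ball_eq l S z h0 hρ] with ρ' h'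
  simp [volume, h']

open scoped Classical in
theorem hasDerivAt_coVolume (l : V → V → ℝ≥0∞) (F : Finset E) (S : Finset V) (β : ℝ) (z : V)
    {ρ : ℝ} (h0 : 0 < ρ) (hρ : ρ ∉ (fun v => (l z v).toReal) '' (S : Set V)) :
    HasDerivAt (G.coVolume l F S β z)
      (-((F.filter fun e => e ∈ G.boundary S (ball l S z ρ)).card : ℝ)) ρ := by
  have hd : ∀ (F' : Finset E) (c : E → ℝ), HasDerivAt (fun ρ' : ℝ => ∑ e ∈ F', (c e - ρ'))
      (-(F'.card : ℝ)) ρ := fun F' c => by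
    have := HasDerivAt.fun_sum (u := F') (A := fun e (ρ' : ℝ) => c e - ρ') (A' := fun _ => (-1 : ℝ))
      (x := ρ) fun e _ => (hasDerivAt_id' ρ).const_sub _
    simpa using this
  have key := (((hasDerivAt_const ρ (β + ∑ e ∈ F with
    G.left e ∈ S \ ball l S z ρ ∧ G.right e ∈ S \ ball l S z ρ,
      (l (G.left e) (G.right e)).toReal)).add
    (hd (F.filter fun e => G.left e ∈ ball l S z ρ ∧ G.right e ∈ S \ ball l S z ρ)
      fun e => (l z (G.right e)).toReal)).add
    (hd (F.filter fun e => G.right e ∈ ball l S z ρ ∧ G.left e ∈ S \ ball l S z ρ)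
      fun e => (l z (G.left e)).toReal))
  rw [card_boundary_inter, neg_add]
  rw [zero_add] at key
  refine key.congr_of_eventuallyEq ?_
  filter_upwards [eventually_ball_eq l S z h0 hρ] with ρ' h'
  simp [coVolume, h']

end MultiGraph

/-! ### The double logarithm of a volume ratio -/

section LogLog

open Real

theorem one_le_log_exp_mul_div {X u : ℝ} (hu : 0 < u) (huX : u ≤ X) :
    1 ≤ log (exp 1 * X / u) := by
  have := hu.trans_le huX
  rw [le_log_iff_exp_le (by positivity), le_div_iff₀ hu]
  gcongr

theorem log_log_nonneg {X u : ℝ} (hu : 0 < u) (huX : u ≤ X) : 0 ≤ log (log (exp 1 * X / u)) :=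
  log_nonneg (one_le_log_exp_mul_div hu huX)

theorem log_log_anti {X u v : ℝ} (hu : 0 < u) (huv : u ≤ v) (hvX : v ≤ X) :
    log (log (exp 1 * X / v)) ≤ log (log (exp 1 * X / u)) := by
  have hv := hu.trans_le huv
  have hX := hv.trans_le hvX
  refine log_le_log (by linarith [one_le_log_exp_mul_div hv hvX]) (log_le_log (by positivity) ?_)
  gcongr

/-- The seed volume β keeps X/u below c. With c = r + 1 this bounds the total variation of the
double logarithm over all radii. -/
theorem log_log_le {X u β c : ℝ} (hβ : 0 < β) (hu : β ≤ u) (huX : u ≤ X) (hX : X ≤ c * β) :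
    log (log (exp 1 * X / u)) ≤ log (log (exp 1 * c)) := by
  have hu0 := hβ.trans_le hu
  have hX0 := hu0.trans_le huX
  refine log_le_log (by linarith [one_le_log_exp_mul_div hu0 huX]) (log_le_log (by positivity) ?_)
  rw [div_le_iff₀ hu0, mul_assoc]
  have hc : 0 ≤ c := by
    by_contra! h
    nlinarith
  gcongr
  exact hX.trans (by gcongr)

/-- When f is a volume, f' is up to sign the cut size, so a derivative bound here compares the cut
with f ln(eX/f). -/
theorem HasDerivAt.log_log {f : ℝ → ℝ} {f' X ρ : ℝ} (hf : HasDerivAt f f' ρ) (h0 : 0 < f ρ)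
    (hX : f ρ ≤ X) :
    HasDerivAt (fun t => Real.log (Real.log (Real.exp 1 * X / f t)))
      (-(f' / (f ρ * Real.log (Real.exp 1 * X / f ρ)))) ρ := by
  have h1 := one_le_log_exp_mul_div h0 hX
  have hX0 := h0.trans_le hX
  have h2 : HasDerivAt (fun t => Real.exp 1 * X / f t) (-(Real.exp 1 * X * f') / f ρ ^ 2) ρ := by
    simpa using (hasDerivAt_const ρ (Real.exp 1 * X)).fun_div hf h0.ne'
  have h3 := (h2.log (by positivity)).log (by linarith)
  convert h3 using 1
  have : Real.log (Real.exp 1 * X / f ρ) ≠ 0 := by linarith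
  field_simp

theorem log_log_exp_mul_pos {r : ℕ} (hr : 1 ≤ r) : 0 < log (log (exp 1 * (r + 1))) := by
  have h1 : (1 : ℝ) ≤ r := by exact_mod_cast hr
  refine log_pos ?_
  rw [lt_log_iff_exp_lt (by positivity)]
  nlinarith [exp_pos 1]

end LogLog

/-! ### Existence of good radii -/

namespace RoundingData

theorem source_mem_ball {V E : Type*} {r : ℕ} {D : RoundingData V E r} {S : Finset V}
    {i : Fin r} (hs : D.s i ∈ S) (ρ : ℝ) :
    D.s i ∈ D.ball S i ρ :=
  MultiGraph.mem_ball.2 ⟨hs, by simp [dist, MultiGraph.pathDist_self]⟩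

variable {V E : Type*} [Fintype E] {r : ℕ} (D : RoundingData V E r)

/-- The properties of the subdivided graph and its fractional solution on which the analysis of the
algorithm rests. -/
structure Admissible (k : ℕ) : Prop where
  x_nonneg : ∀ e, 0 ≤ D.x e
  y_nonneg : ∀ i e, 0 ≤ D.y i e
  x_eq_zero : ∀ e ∉ D.F, D.x e = 0
  y_eq_zero : ∀ i, ∀ e ∈ D.F, D.y i e = 0
  sum_y_le : ∀ i, ∑ e, D.y i e ≤ (k : ℝ) - 1
  one_le_dist : ∀ i, 1 ≤ D.dist i (D.s i) (D.t i)

open scoped Classical in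
/-- The total `x`-value of the edges inside `S`. -/
def weight (S : Finset V) : ℝ := ∑ e with e ∈ D.graph.inside S, D.x e

theorem xVolume_eq (S : Finset V) : D.xVolume S = D.β + D.weight S := rfl

variable {D} {k : ℕ}

theorem Admissible.len_nonneg (hD : D.Admissible k) (i : Fin r) (e : E) : 0 ≤ D.x e + D.y i e :=
  add_nonneg (hD.x_nonneg e) (hD.y_nonneg i e)

theorem Admissible.opt_nonneg (hD : D.Admissible k) : 0 ≤ D.opt :=
  Finset.sum_nonneg fun e _ => hD.x_nonneg e

theorem Admissible.β_nonneg (hD : D.Admissible k) : 0 ≤ D.β :=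
  div_nonneg hD.opt_nonneg (Nat.cast_nonneg r)

theorem Admissible.weight_nonneg (hD : D.Admissible k) (S : Finset V) : 0 ≤ D.weight S :=
  Finset.sum_nonneg fun e _ => hD.x_nonneg e

theorem Admissible.weight_le_opt (hD : D.Admissible k) (S : Finset V) : D.weight S ≤ D.opt :=
  Finset.sum_le_univ_sum_of_nonneg fun e => hD.x_nonneg e

theorem Admissible.weight_mono (hD : D.Admissible k) {A S : Finset V} (h : A ⊆ S) :
    D.weight A ≤ D.weight S := by
  classical
  refine Finset.sum_le_sum_of_subset_of_nonneg ?_ fun e _ _ => hD.x_nonneg e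
  exact Finset.monotone_filter_right _ fun e _ he => ⟨h he.1, h he.2⟩

open scoped Classical in
theorem Admissible.weight_add_weight_sdiff_le (hD : D.Admissible k) {A S : Finset V} (h : A ⊆ S) :
    D.weight A + D.weight (S \ A) ≤ D.weight S := by
  classical
  unfold weight
  rw [← Finset.sum_union]
  · refine Finset.sum_le_sum_of_subset_of_nonneg ?_ fun e _ _ => hD.x_nonneg e
    intro e
    simp only [Finset.mem_union, Finset.mem_filter, Finset.mem_univ, true_and]
    rintro (he | he)
    · exact ⟨h he.1, h he.2⟩
    · exact ⟨Finset.sdiff_subset he.1, Finset.sdiff_subset he.2⟩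
  · rw [Finset.disjoint_filter]
    exact fun e _ h1 h2 => (Finset.mem_sdiff.1 h2.1).2 h1.1

open scoped Classical in
theorem Admissible.sum_len_eq_weight (hD : D.Admissible k) (i : Fin r) (S : Finset V) :
    ∑ e ∈ D.F with e ∈ D.graph.inside S, (D.x e + D.y i e) = D.weight S := by
  unfold weight
  rw [Finset.sum_filter, Finset.sum_filter]
  refine Finset.sum_subset_zero_on_sdiff (Finset.subset_univ _) (fun e he => ?_) fun e he => ?_
  · simp [hD.x_eq_zero e (Finset.mem_sdiff.1 he).2]
  · simp [hD.y_eq_zero i e he]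

theorem Admissible.le_volume (hD : D.Admissible k) (S : Finset V) (i : Fin r) {ρ : ℝ} (h0 : 0 ≤ ρ) :
    D.β ≤ D.graph.volume (D.dist i) D.F S D.β (D.s i) ρ :=
  MultiGraph.le_volume (hD.len_nonneg i) _ _ _ _ h0

theorem Admissible.le_coVolume (hD : D.Admissible k) (S : Finset V) (i : Fin r) {ρ : ℝ} (h0 : 0 ≤ ρ) :
    D.β ≤ D.graph.coVolume (D.dist i) D.F S D.β (D.s i) ρ :=
  MultiGraph.le_coVolume (hD.len_nonneg i) _ _ _ _ h0

open scoped Classical in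
theorem Admissible.volume_le (hD : D.Admissible k) (S : Finset V) (i : Fin r) {ρ : ℝ} (h0 : 0 ≤ ρ) :
    D.graph.volume (D.dist i) D.F S D.β (D.s i) ρ ≤
      D.β + (D.weight S - D.weight (S \ D.ball S i ρ)) := by
  classical
  have := MultiGraph.volume_le (G := D.graph) (hD.len_nonneg i) D.F S D.β (D.s i) h0
  rw [hD.sum_len_eq_weight, hD.sum_len_eq_weight] at this
  exact this

theorem Admissible.coVolume_le (hD : D.Admissible k) (S : Finset V) (i : Fin r) {ρ : ℝ} (h0 : 0 ≤ ρ) :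
    D.graph.coVolume (D.dist i) D.F S D.β (D.s i) ρ ≤
      D.β + (D.weight S - D.weight (D.ball S i ρ)) := by
  classical
  have := MultiGraph.coVolume_le (G := D.graph) (hD.len_nonneg i) D.F S D.β (D.s i) h0
  rw [hD.sum_len_eq_weight, hD.sum_len_eq_weight] at this
  exact this

theorem Admissible.sink_notMem_ball (hD : D.Admissible k) (S : Finset V) (i : Fin r) {ρ : ℝ}
    (h1 : ρ < 1) : D.t i ∉ D.ball S i ρ := fun h => by
  have := (hD.one_le_dist i).trans (MultiGraph.mem_ball.1 h).2
  rw [ENNReal.one_le_ofReal] at this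
  linarith

theorem Admissible.xVolume_le (hD : D.Admissible k) (hr : 1 ≤ r) (S : Finset V) :
    D.xVolume S ≤ (r + 1) * D.β := by
  have hr0 : (r : ℝ) ≠ 0 := by positivity
  have : D.opt = r * D.β := by
    unfold β
    field_simp
  linarith [D.xVolume_eq S, hD.weight_le_opt S]

/-- Edges outside `D.F` have length y alone, and the LP bounds the total y-length of a commodity. -/
theorem Admissible.volume_compl_le (hD : D.Admissible k) [DecidableEq E] (S : Finset V) (i : Fin r)
    {ρ : ℝ} (h0 : 0 ≤ ρ) :
    D.graph.volume (D.dist i) D.Fᶜ S 0 (D.s i) ρ ≤ (k : ℝ) - 1 := by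
  classical
  refine (MultiGraph.volume_le (G := D.graph) (hD.len_nonneg i) D.Fᶜ S 0 (D.s i) h0).trans ?_
  rw [zero_add]
  refine (sub_le_self _ (Finset.sum_nonneg fun e _ => hD.len_nonneg i e)).trans ?_
  refine le_trans ?_ (hD.sum_y_le i)
  rw [Finset.sum_congr rfl fun e he => by
    rw [hD.x_eq_zero e (by simpa using (Finset.mem_filter.1 he).1), zero_add]]
  exact Finset.sum_le_univ_sum_of_nonneg (hD.y_nonneg i)

open scoped Classical in
/-- Radii at which few edges outside `F` are cut, and at which the cut edges of `F` are few compared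
with the volumes on both sides. -/
theorem Admissible.exists_radius (hD : D.Admissible k) (hr : 1 ≤ r) (hk : 2 ≤ k) (hβ : 0 < D.β)
    {γ : ℝ} (hγ : 1 < γ) (S : Finset V) (i : Fin r) :
    ∃ ρ ∈ Set.Ioo (0 : ℝ) 1,
      ((D.Fᶜ.filter fun e => e ∈ D.graph.boundary S (D.ball S i ρ)).card : ℝ)
        ≤ √γ * ((k : ℝ) - 1) ∧
      ∀ W ∈ ({D.graph.volume (D.dist i) D.F S D.β (D.s i) ρ,
          D.graph.coVolume (D.dist i) D.F S D.β (D.s i) ρ} : Set ℝ),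
        ((D.F.filter fun e => e ∈ D.graph.boundary S (D.ball S i ρ)).card : ℝ) ≤
          2 * √γ / (√γ - 1) * Real.log (Real.log (Real.exp 1 * (r + 1))) *
            (W * Real.log (Real.exp 1 * D.xVolume S / W)) := by
  set L : ℝ := Real.log (Real.log (Real.exp 1 * (r + 1))) with hL
  set X := D.xVolume S with hX
  set v := D.graph.volume (D.dist i) D.F S D.β (D.s i) with hv
  set w := D.graph.coVolume (D.dist i) D.F S D.β (D.s i) with hw
  set u := D.graph.volume (D.dist i) D.Fᶜ S 0 (D.s i) with hu
  have hL0 : 0 < L := log_log_exp_mul_pos hr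
  have hXle : X ≤ (r + 1) * D.β := hD.xVolume_le hr S
  have hg : 1 < √γ := Real.lt_sqrt_of_sq_lt (by simpa using hγ)
  have hk1 : (0 : ℝ) < (k : ℝ) - 1 := by
    have : (2 : ℝ) ≤ k := by exact_mod_cast hk
    linarith
  have hvX : ∀ ρ, 0 ≤ ρ → v ρ ≤ X := fun ρ h => by
    linarith [hD.volume_le S i h, hD.weight_nonneg (S \ D.ball S i ρ), D.xVolume_eq S]
  have hwX : ∀ ρ, 0 ≤ ρ → w ρ ≤ X := fun ρ h => by
    linarith [hD.coVolume_le S i h, hD.weight_nonneg (D.ball S i ρ), D.xVolume_eq S]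
  have hvβ : ∀ ρ, 0 ≤ ρ → D.β ≤ v ρ := fun ρ h => hD.le_volume S i h
  have hwβ : ∀ ρ, 0 ≤ ρ → D.β ≤ w ρ := fun ρ h => hD.le_coVolume S i h
  have hvm : MonotoneOn v (Set.Icc 0 1) := MultiGraph.volume_monotoneOn (hD.len_nonneg i) _ _ _ _
  have hwm : AntitoneOn w (Set.Icc 0 1) :=
    MultiGraph.coVolume_antitoneOn (hD.len_nonneg i) _ _ _ _
  have hum : MonotoneOn u (Set.Icc 0 1) := MultiGraph.volume_monotoneOn (hD.len_nonneg i) _ _ _ _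
  -- Chosen so that 1/√γ + 2L/a = 1: the share 1/√γ of the unit budget goes to the edges outside
  -- `D.F`, and the rest is split evenly between the two volumes.
  set a : ℝ := 2 * √γ / (√γ - 1) * L with ha
  have hg1 : 0 < √γ - 1 := by linarith
  have ha0 : 0 < a := by positivity
  set cx : ℝ → ℝ := fun ρ =>
    ((D.F.filter fun e => e ∈ D.graph.boundary S (D.ball S i ρ)).card : ℝ) with hcx
  set cy : ℝ → ℝ := fun ρ =>
    ((D.Fᶜ.filter fun e => e ∈ D.graph.boundary S (D.ball S i ρ)).card : ℝ) with hcy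
  obtain ⟨ρ, hρ, hle⟩ := MonotoneOn.exists_deriv_le_one
    (N := (fun z => (D.dist i (D.s i) z).toReal) '' (S : Set V))
    (H := fun ρ => u ρ / (√γ * ((k : ℝ) - 1)) +
      (-Real.log (Real.log (Real.exp 1 * X / v ρ))) / a +
      Real.log (Real.log (Real.exp 1 * X / w ρ)) / a)
    (h := fun ρ => cy ρ / (√γ * ((k : ℝ) - 1)) +
      (cx ρ / (v ρ * Real.log (Real.exp 1 * X / v ρ))) / a +
      (cx ρ / (w ρ * Real.log (Real.exp 1 * X / w ρ))) / a)
    (S.finite_toSet.image _).countable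
    (fun ρ hρ ρ' hρ' h => by
      have h1 := hum hρ hρ' h
      have h2 := log_log_anti (hβ.trans_le (hvβ ρ hρ.1)) (hvm hρ hρ' h) (hvX ρ' hρ'.1)
      have h3 := log_log_anti (hβ.trans_le (hwβ ρ' hρ'.1)) (hwm hρ hρ' h) (hwX ρ hρ.1)
      dsimp only
      gcongr)
    (by
      have h1 := hD.volume_compl_le S i zero_le_one
      have h2 := MultiGraph.le_volume (G := D.graph) (hD.len_nonneg i) D.Fᶜ S 0 (D.s i)
        (le_refl (0 : ℝ))
      have h3 := log_log_nonneg (hβ.trans_le (hvβ 1 zero_le_one)) (hvX 1 zero_le_one)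
      have h4 := log_log_le hβ (hvβ 0 le_rfl) (hvX 0 le_rfl) hXle
      have h5 := log_log_nonneg (hβ.trans_le (hwβ 0 le_rfl)) (hwX 0 le_rfl)
      have h6 := log_log_le hβ (hwβ 1 zero_le_one) (hwX 1 zero_le_one) hXle
      calc _ = (u 1 - u 0) / (√γ * ((k : ℝ) - 1)) +
            (Real.log (Real.log (Real.exp 1 * X / v 0)) -
              Real.log (Real.log (Real.exp 1 * X / v 1))) / a +
            (Real.log (Real.log (Real.exp 1 * X / w 1)) -
              Real.log (Real.log (Real.exp 1 * X / w 0))) / a := by ring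
        _ ≤ ((k : ℝ) - 1) / (√γ * ((k : ℝ) - 1)) + L / a + L / a := by
          have h7 : u 1 - u 0 ≤ (k : ℝ) - 1 := (sub_le_self _ h2).trans h1
          exact add_le_add (add_le_add (div_le_div_of_nonneg_right h7 (by positivity))
            (div_le_div_of_nonneg_right ((sub_le_self _ h3).trans h4) ha0.le))
            (div_le_div_of_nonneg_right ((sub_le_self _ h5).trans h6) ha0.le)
        _ = 1 := by
          rw [ha]
          field_simp
          ring)
    (fun ρ hρ hN => by
      have h1 := MultiGraph.hasDerivAt_volume (G := D.graph) (D.dist i) D.Fᶜ S 0 (D.s i) hρ.1 hN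
      have h2 := (MultiGraph.hasDerivAt_volume (G := D.graph) (D.dist i) D.F S D.β (D.s i) hρ.1
        hN).log_log (hβ.trans_le (hvβ ρ hρ.1.le)) (hvX ρ hρ.1.le)
      have h3 := (MultiGraph.hasDerivAt_coVolume (G := D.graph) (D.dist i) D.F S D.β (D.s i) hρ.1
        hN).log_log (hβ.trans_le (hwβ ρ hρ.1.le)) (hwX ρ hρ.1.le)
      replace h2 := h2.neg
      rw [neg_neg] at h2
      rw [neg_div, neg_neg] at h3
      exact ((h1.div_const (√γ * ((k : ℝ) - 1))).add (h2.div_const a)).add (h3.div_const a))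
  have hv0 : 0 < v ρ := hβ.trans_le (hvβ ρ hρ.1.le)
  have hw0 : 0 < w ρ := hβ.trans_le (hwβ ρ hρ.1.le)
  have hv1 : 0 < v ρ * Real.log (Real.exp 1 * X / v ρ) :=
    mul_pos hv0 (by linarith [one_le_log_exp_mul_div hv0 (hvX ρ hρ.1.le)])
  have hw1 : 0 < w ρ * Real.log (Real.exp 1 * X / w ρ) :=
    mul_pos hw0 (by linarith [one_le_log_exp_mul_div hw0 (hwX ρ hρ.1.le)])
  have hcx0 : 0 ≤ cx ρ := Nat.cast_nonneg _
  have hcy0 : 0 ≤ cy ρ := Nat.cast_nonneg _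
  -- All three terms are nonnegative and sum to at most 1, so one radius serves all three bounds
  -- simultaneously.
  have e1 : 0 ≤ cy ρ / (√γ * ((k : ℝ) - 1)) := by positivity
  have e2 : 0 ≤ cx ρ / (v ρ * Real.log (Real.exp 1 * X / v ρ)) / a := by positivity
  have e3 : 0 ≤ cx ρ / (w ρ * Real.log (Real.exp 1 * X / w ρ)) / a := by positivity
  refine ⟨ρ, hρ, ?_, ?_⟩
  · have : cy ρ / (√γ * ((k : ℝ) - 1)) ≤ 1 := by linarith
    rwa [div_le_one (by positivity)] at this
  · rintro W (rfl | rfl)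
    · have : cx ρ / (v ρ * Real.log (Real.exp 1 * X / v ρ)) / a ≤ 1 := by linarith
      rwa [div_le_one ha0, div_le_iff₀ hv1] at this
    · have : cx ρ / (w ρ * Real.log (Real.exp 1 * X / w ρ)) / a ≤ 1 := by linarith
      rwa [div_le_one ha0, div_le_iff₀ hw1] at this

open scoped Classical in
theorem card_boundary_eq (S : Finset V) (i : Fin r) (ρ : ℝ) :
    ((D.graph.boundary S (D.ball S i ρ)).card : ℝ) =
      (D.F.filter fun e => e ∈ D.graph.boundary S (D.ball S i ρ)).card +
      (D.Fᶜ.filter fun e => e ∈ D.graph.boundary S (D.ball S i ρ)).card := by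
  rw [← Nat.cast_add, ← Finset.card_union_of_disjoint
    (Finset.disjoint_filter_filter disjoint_compl_right), ← Finset.filter_union,
    Finset.union_compl, Finset.filter_mem_eq_inter, Finset.univ_inter]

theorem Admissible.le_card_boundary (hD : D.Admissible k) {q : ℝ} {S : Finset V} {i : Fin r}
    (hs : D.s i ∈ S) (hc : D.graph.AtLeastConnected (D.graph.inside S) (D.s i) (D.t i) q)
    {ρ : ℝ} (h1 : ρ < 1) : q ≤ (D.graph.boundary S (D.ball S i ρ)).card := by
  obtain ⟨m, hm, hp⟩ := hc
  refine hm.trans ?_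
  exact_mod_cast hp.le_card_boundary (source_mem_ball hs ρ) (hD.sink_notMem_ball S i h1)

/-- If the fractional solution has value `0`, no pair is more than `(k-1)`-connected. -/
theorem Admissible.β_pos (hD : D.Admissible k) (hr : 1 ≤ r) (hk : 2 ≤ k) {γ : ℝ} (hγ : 1 < γ)
    {S : Finset V} {i : Fin r} (hs : D.s i ∈ S)
    (hc : D.graph.AtLeastConnected (D.graph.inside S) (D.s i) (D.t i) (γ * ((k : ℝ) - 1))) :
    0 < D.β := by
  classical
  have hr0 : (0 : ℝ) < r := by exact_mod_cast hr
  have hk1 : (0 : ℝ) < (k : ℝ) - 1 := by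
    have : (2 : ℝ) ≤ k := by exact_mod_cast hk
    linarith
  by_contra hβ
  have hopt : D.opt = 0 := by
    by_contra h
    exact hβ (div_pos (lt_of_le_of_ne hD.opt_nonneg (Ne.symm h)) hr0)
  have hx : ∀ e, D.x e = 0 := fun e =>
    (Finset.sum_eq_zero_iff_of_nonneg fun e _ => hD.x_nonneg e).1 hopt e (Finset.mem_univ e)
  -- With x = 0 the whole budget can go to the edges outside `D.F`: some ball cuts at most k - 1 of
  -- them.
  obtain ⟨ρ, hρ, hle⟩ := MonotoneOn.exists_deriv_le_one
    (N := (fun z => (D.dist i (D.s i) z).toReal) '' (S : Set V))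
    (H := fun ρ => D.graph.volume (D.dist i) D.Fᶜ S 0 (D.s i) ρ / ((k : ℝ) - 1))
    (h := fun ρ => ((D.Fᶜ.filter fun e => e ∈ D.graph.boundary S (D.ball S i ρ)).card : ℝ) /
      ((k : ℝ) - 1))
    (S.finite_toSet.image _).countable
    (fun ρ hρ ρ' hρ' h => by
      have h1 := MultiGraph.volume_monotoneOn (G := D.graph) (hD.len_nonneg i) D.Fᶜ S 0 (D.s i)
        hρ hρ' h
      exact div_le_div_of_nonneg_right h1 hk1.le)
    (by
      have h1 := hD.volume_compl_le S i zero_le_one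
      have h2 := MultiGraph.le_volume (G := D.graph) (hD.len_nonneg i) D.Fᶜ S 0 (D.s i)
        (le_refl (0 : ℝ))
      rw [← sub_div, div_le_one hk1]
      exact (sub_le_self _ h2).trans h1)
    (fun ρ hρ hN => (MultiGraph.hasDerivAt_volume (G := D.graph) (D.dist i) D.Fᶜ S 0 (D.s i) hρ.1
      hN).div_const _)
  rw [div_le_one hk1] at hle
  have hcut := hD.le_card_boundary hs hc hρ.2
  -- Edges of `D.F` now have length 0, so no ball can cut them. The cut then has at most k - 1 <
  -- γ(k-1) edges, against the connectivity.
  have hF : (D.F.filter fun e => e ∈ D.graph.boundary S (D.ball S i ρ)) = ∅ := by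
    refine Finset.filter_eq_empty_iff.2 fun e he hb => ?_
    obtain ⟨u, hu, v, hv, hv', hj⟩ := MultiGraph.mem_boundary.1 hb
    refine hv' (MultiGraph.mem_ball.2 ⟨hv, ?_⟩)
    refine (MultiGraph.pathDist_triangle (hD.len_nonneg i) _ u _).trans ?_
    have h1 := MultiGraph.pathDist_le_of_joins (fun e => D.x e + D.y i e) hj
    rw [hx e, hD.y_eq_zero i e he, add_zero, ENNReal.ofReal_zero, nonpos_iff_eq_zero] at h1
    rw [h1, add_zero]
    exact (MultiGraph.mem_ball.1 hu).2
  rw [card_boundary_eq, hF, Finset.card_empty, Nat.cast_zero, zero_add] at hcut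
  nlinarith

/-- The cut has at least γ(k-1) edges, of which at most √γ(k-1), a fraction 1/√γ, lie outside `D.F`.
So the cut is at most √γ/(√γ-1) times its part in `D.F`. A second such factor is already in
`exists_radius`, which explains the square in the bound. -/
theorem Admissible.exists_goodRadius (hD : D.Admissible k) (hr : 1 ≤ r) (hk : 2 ≤ k) {γ : ℝ}
    (hγ : 1 < γ) {S : Finset V} {i : Fin r} (hs : D.s i ∈ S)
    (hc : D.graph.AtLeastConnected (D.graph.inside S) (D.s i) (D.t i) (γ * ((k : ℝ) - 1))) :
    ∃ ρ, D.GoodRadius γ S i ρ := by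
  classical
  obtain ⟨ρ, hρ, hy, hW⟩ := hD.exists_radius hr hk (hD.β_pos hr hk hγ hs hc) hγ S i
  have hcut := hD.le_card_boundary hs hc hρ.2
  have hsum := D.card_boundary_eq S i ρ
  have hg : 1 < √γ := Real.lt_sqrt_of_sq_lt (by simpa using hγ)
  have hγ' : √γ * √γ = γ := Real.mul_self_sqrt (by linarith)
  set c : ℝ := ((D.graph.boundary S (D.ball S i ρ)).card : ℝ) with hcdef
  have hg1 : 0 < √γ - 1 := by linarith
  have key : ∀ W ∈ ({D.graph.volume (D.dist i) D.F S D.β (D.s i) ρ,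
      D.graph.coVolume (D.dist i) D.F S D.β (D.s i) ρ} : Set ℝ),
      c ≤ 2 * γ / (√γ - 1) ^ 2 * W * Real.log (Real.exp 1 * D.xVolume S / W) *
        Real.log (Real.log (Real.exp 1 * (r + 1))) := fun W hWm => by
    have h := hW W hWm
    have h1 : (√γ - 1) * c ≤
        √γ * (D.F.filter fun e => e ∈ D.graph.boundary S (D.ball S i ρ)).card := by
      nlinarith
    have h2 : c ≤ √γ / (√γ - 1) *
        (D.F.filter fun e => e ∈ D.graph.boundary S (D.ball S i ρ)).card := by
      rw [div_mul_eq_mul_div, le_div_iff₀ hg1, mul_comm c]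
      exact h1
    calc c ≤ _ := h2
      _ ≤ √γ / (√γ - 1) * (2 * √γ / (√γ - 1) * Real.log (Real.log (Real.exp 1 * (r + 1))) *
            (W * Real.log (Real.exp 1 * D.xVolume S / W))) := by gcongr
      _ = 2 * (√γ * √γ) / (√γ - 1) ^ 2 * W * Real.log (Real.exp 1 * D.xVolume S / W) *
        Real.log (Real.log (Real.exp 1 * (r + 1))) := by
          field_simp
      _ = _ := by rw [hγ']
  exact ⟨ρ, hρ.1.le, hρ.2, key _ (Or.inl rfl), key _ (Or.inr rfl)⟩

end RoundingData

/-! ### Confinement of disjoint paths -/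

namespace MultiGraph

variable {V E : Type*} {G : MultiGraph V E}

/-- Edge-disjoint paths that start in `X` and use no edge that leaves `X` stay inside `X`. -/
theorem HasDisjointPaths.inside_of_closed {F Q : Set E} {X : Finset V} {u v : V} {m : ℕ}
    (h : G.HasDisjointPaths (F ∩ Q) u v m) (hu : u ∈ X) (hm : 0 < m)
    (hX : ∀ e ∈ F ∩ Q, ∀ a ∈ X, ∀ b, G.Joins e a b → b ∈ X) :
    v ∈ X ∧ G.HasDisjointPaths (G.inside X ∩ Q) u v m := by
  obtain ⟨P, hP, hd⟩ := h
  have key := fun j => (P j).forall_inside hu fun e he => hX e ((hP j).2 e he)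
  exact ⟨(key ⟨0, hm⟩).1, P,
    fun j => ⟨(hP j).1, fun e he => ⟨(key j).2 e he, ((hP j).2 e he).2⟩⟩, hd⟩

end MultiGraph

/-! ### The inequality that pays for one carved region -/

section RealBounds

open Real

theorem log_exp_mul_div {X W : ℝ} (hX : 0 < X) (hW : 0 < W) :
    log (exp 1 * X / W) = 1 + log X - log W := by
  rw [log_div (by positivity) hW.ne', log_mul (by positivity) hX.ne', log_exp]

/-- The derivative in W is ln(X/W) ≥ 0; the proof uses ln t ≤ t - 1 instead. It allows a volume to
be replaced by its upper bound in the charge. -/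
theorem mul_log_exp_mul_div_mono {X W W' : ℝ} (hW : 0 < W) (hWW : W ≤ W') (hX : W' ≤ X) :
    W * log (exp 1 * X / W) ≤ W' * log (exp 1 * X / W') := by
  have hW' := hW.trans_le hWW
  have hX0 := hW'.trans_le hX
  rw [log_exp_mul_div hX0 hW, log_exp_mul_div hX0 hW']
  have h1 : log W' - log W ≤ W' / W - 1 := by
    rw [← log_div hW'.ne' hW.ne']
    exact log_le_sub_one_of_pos (by positivity)
  have h2 : W * (log W' - log W) ≤ W' - W := by
    calc _ ≤ W * (W' / W - 1) := by gcongr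
      _ = _ := by field_simp
  have h3 : log W' ≤ log X := log_le_log hW' hX
  nlinarith

/-- The cost of one carved region and of the recursive call on it: `wA`, `wR`, `wS` are the weights
of the region, of the remaining set and of the current set. -/
theorem region_cost_le {cut P β wS wA wR W c g gA nA R : ℝ} (hP : 0 ≤ P) (hβ : 0 < β)
    (hA : 0 ≤ wA) (hR : 0 ≤ wR) (hSAR : wA + wR ≤ wS) (hW : β ≤ W) (hW' : W ≤ β + (wS - wR))
    (hc : c = log (exp 1 * R)) (hXR : β + wS ≤ R * β) (hg : gA + 1 ≤ g) (hgA : 0 ≤ gA)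
    (hcut : cut ≤ P * (W * log (exp 1 * (β + wS) / W))) :
    cut + P * (wA * (gA + log ((β + wA) / β)) + β * nA * c) ≤
      P * ((wS - wR) * (g + log ((β + wS) / β)) + β * (1 + nA) * c) := by
  set W' := β + (wS - wR) with hW'def
  set X := β + wS with hX
  have hW0 := hβ.trans_le hW
  have hW'0 : 0 < W' := hW0.trans_le hW'
  have hX0 : 0 < X := by linarith
  have hmono := mul_log_exp_mul_div_mono hW0 hW' (X := X) (by linarith)
  have hR0 : 0 < R := by
    by_contra! h
    nlinarith
  -- Used only for the β-part of `W'`, which is charged to the separated pair.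
  have h1 : log (exp 1 * X / W') ≤ c := by
    rw [hc]
    refine log_le_log (by positivity) ?_
    rw [div_le_iff₀ hW'0, mul_assoc]
    gcongr
    exact hXR.trans (by gcongr; linarith)
  have h2 : log (exp 1 * X / W') = 1 + log X - log W' := log_exp_mul_div hX0 hW'0
  have h3 : log (β + wA) ≤ log W' := log_le_log (by linarith) (by linarith)
  have h4 : log β ≤ log (β + wA) := log_le_log hβ (by linarith)
  rw [log_div (by positivity) hβ.ne', log_div hX0.ne' hβ.ne']
  -- The -1, gained by halving the pairs, cancels the 1 in ln(eX/W') = 1 + ln X - ln W' of `h6`, and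
  -- the terms ln W' cancel too, leaving g + ln(X/β).
  have h5 : wA * (gA + (log (β + wA) - log β)) ≤ (wS - wR) * (g - 1 + (log W' - log β)) :=
    mul_le_mul (by linarith) (by linarith) (by linarith) (by linarith)
  have h6 : W * log (exp 1 * X / W) ≤ β * c + (wS - wR) * (1 + log X - log W') := by
    calc _ ≤ _ := hmono
      _ = β * log (exp 1 * X / W') + (wS - wR) * log (exp 1 * X / W') := by rw [hW'def]; ring
      _ ≤ β * c + (wS - wR) * log (exp 1 * X / W') := by gcongr
      _ = _ := by rw [h2]
  calc _ ≤ P * (β * c + (wS - wR) * (1 + log X - log W')) +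
        P * ((wS - wR) * (g - 1 + (log W' - log β)) + β * nA * c) := by
        refine add_le_add (hcut.trans ?_) ?_ <;> gcongr
    _ = _ := by ring

end RealBounds

/-- The factor 2 inside the logarithms makes a = 0, n = 1 work: `Nat.log 2 0 = 0`, while `Nat.log 2
2 = 1`. -/
theorem Nat.log_two_mul_succ_le {a n : ℕ} (h : 2 * a ≤ n) (hn : 0 < n) :
    Nat.log 2 (2 * a) + 1 ≤ Nat.log 2 (2 * n) := by
  rw [mul_comm 2 n, Nat.log_mul_base (by norm_num) hn.ne']
  gcongr

/-! ### Termination, correctness and cost of the recursion -/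

namespace RoundingData

variable {V E : Type*} {r : ℕ} {D : RoundingData V E r} {γ : ℝ} {k : ℕ} {χ : Choices V r}
  {T : Finset (Fin r)} {S : Finset V}

theorem mem_pairsIn {X : Finset V} {i : Fin r} :
    i ∈ D.pairsIn T X ↔ i ∈ T ∧ D.s i ∈ X ∧ D.t i ∈ X := by
  classical
  simp [pairsIn]

theorem mem_active {i : Fin r} :
    i ∈ D.active γ k T S ↔ (i ∈ T ∧ D.s i ∈ S ∧ D.t i ∈ S) ∧
      D.graph.AtLeastConnected (D.graph.inside S) (D.s i) (D.t i) (γ * ((k : ℝ) - 1)) := by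
  classical
  simp [active, mem_pairsIn]

theorem card_pairsIn_add_le [DecidableEq V] {A : Finset V} (hA : A ⊆ S) :
    (D.pairsIn T A).card + (D.pairsIn T (S \ A)).card ≤ (D.pairsIn T S).card := by
  classical
  rw [← Finset.card_union_of_disjoint]
  · refine Finset.card_le_card fun i hi => ?_
    simp only [Finset.mem_union, mem_pairsIn, Finset.mem_sdiff] at hi ⊢
    rcases hi with hi | hi
    · exact ⟨hi.1, hA hi.2.1, hA hi.2.2⟩
    · exact ⟨hi.1, hi.2.1.1, hi.2.2.1⟩
  · refine Finset.disjoint_left.2 fun i h1 h2 => ?_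
    exact (Finset.mem_sdiff.1 (mem_pairsIn.1 h2).2.1).2 (mem_pairsIn.1 h1).2.1

theorem card_pairsIn_add_lt [DecidableEq V] {A : Finset V} (hA : A ⊆ S) {i : Fin r}
    (hi : i ∈ D.pairsIn T S) (hsep : ¬ (D.s i ∈ A ↔ D.t i ∈ A)) :
    1 + (D.pairsIn T A).card + (D.pairsIn T (S \ A)).card ≤ (D.pairsIn T S).card := by
  classical
  have hiA : i ∉ D.pairsIn T A := fun h =>
    hsep (iff_of_true (mem_pairsIn.1 h).2.1 (mem_pairsIn.1 h).2.2)
  have hiS : i ∉ D.pairsIn T (S \ A) := fun h => hsep (iff_of_false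
    (Finset.mem_sdiff.1 (mem_pairsIn.1 h).2.1).2 (Finset.mem_sdiff.1 (mem_pairsIn.1 h).2.2).2)
  -- Erasing the separated pair lowers the count for `S` by one and leaves both parts unchanged.
  have h1 := card_pairsIn_add_le (D := D) (T := T.erase i) hA
  have h2 : ∀ X, D.pairsIn (T.erase i) X = (D.pairsIn T X).erase i := fun X => by
    ext j
    simp only [mem_pairsIn, Finset.mem_erase]
    tauto
  rw [h2, h2, h2, Finset.erase_eq_of_notMem hiA, Finset.erase_eq_of_notMem hiS,
    Finset.card_erase_of_mem hi] at h1
  have := Finset.card_pos.2 ⟨i, hi⟩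
  omega

variable [Fintype E]

open scoped Classical in
/-- What is known about the region that is carved out of `S`. -/
theorem Admissible.nextRegion_spec (hD : D.Admissible k) (hχ : D.ValidChoices γ k χ)
    (hact : (D.active γ k T S).Nonempty) :
    D.nextRegion χ T S ⊆ S ∧
    (∃ i ∈ D.pairsIn T S, ¬ (D.s i ∈ D.nextRegion χ T S ↔ D.t i ∈ D.nextRegion χ T S)) ∧
    2 * (D.pairsIn T (D.nextRegion χ T S)).card ≤ T.card ∧
    ∃ W, D.β ≤ W ∧ W ≤ D.β + (D.weight S - D.weight (S \ D.nextRegion χ T S)) ∧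
      ((D.graph.boundary S (D.nextRegion χ T S)).card : ℝ) ≤
        2 * γ / (√γ - 1) ^ 2 * Real.log (Real.log (Real.exp 1 * (r + 1))) *
          (W * Real.log (Real.exp 1 * (D.β + D.weight S) / W)) := by
  have hi := hχ.1 T S hact
  set i := χ.pick T S with hidef
  obtain ⟨⟨hiT, hs, ht⟩, hc⟩ := mem_active.1 hi
  obtain ⟨h0, h1, hg1, hg2⟩ := hχ.2 S i (mem_active.2 ⟨⟨Finset.mem_univ _, hs, ht⟩, hc⟩)
  set ρ := χ.radius S i with hρdef
  have hsB := source_mem_ball hs ρ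
  have htB := hD.sink_notMem_ball S i h1
  have hBS : D.ball S i ρ ⊆ S := MultiGraph.ball_subset _ _ _ _
  have hreg : D.nextRegion χ T S = if 2 * (D.pairsIn T (D.ball S i ρ)).card ≤ T.card
    then D.ball S i ρ else S \ D.ball S i ρ := rfl
  rw [xVolume_eq] at hg1 hg2
  rw [hreg]
  split_ifs with hcard
  · refine ⟨hBS, ⟨i, mem_pairsIn.2 ⟨hiT, hs, ht⟩, by tauto⟩, hcard, _, hD.le_volume S i h0,
      hD.volume_le S i h0, hg1.trans_eq (by ring)⟩
  -- Here the ball has more than half of the pairs, so its complement has less than half. The cut is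
  -- the same, and the complementary volume takes the role of `W`.
  · have hss : S \ (S \ D.ball S i ρ) = D.ball S i ρ := by
      rw [sdiff_sdiff_right_self]
      exact inf_eq_right.2 hBS
    refine ⟨Finset.sdiff_subset, ⟨i, mem_pairsIn.2 ⟨hiT, hs, ht⟩, ?_⟩, ?_, _, hD.le_coVolume S i h0,
      ?_, ?_⟩
    · simp [hsB, htB, ht]
    · have h2 := card_pairsIn_add_le (D := D) (T := T) hBS
      have h3 : (D.pairsIn T S).card ≤ T.card :=
        Finset.card_le_card fun j hj => (mem_pairsIn.1 hj).1
      omega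
    · rw [hss]
      exact hD.coVolume_le S i h0
    · rw [MultiGraph.boundary_sdiff hBS]
      exact hg2.trans_eq (by ring)

open scoped Classical in
-- A set that separates a pair of `S` is neither empty nor all of `S`. This gives termination of
-- both the loop and the recursion.
theorem Admissible.nextRegion_card_lt (hD : D.Admissible k) (hχ : D.ValidChoices γ k χ)
    (hact : (D.active γ k T S).Nonempty) :
    (D.nextRegion χ T S).card < S.card ∧ (S \ D.nextRegion χ T S).card < S.card := by
  obtain ⟨hsub, ⟨i, hi, hsep⟩, -⟩ := hD.nextRegion_spec hχ hact
  obtain ⟨-, hs, ht⟩ := mem_pairsIn.1 hi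
  constructor
  · refine Finset.card_lt_card (hsub.ssubset_of_ne fun h => hsep ?_)
    rw [h]
    exact iff_of_true hs ht
  · refine Finset.card_lt_card (Finset.sdiff_ssubset hsub ?_)
    by_contra h
    rw [Finset.not_nonempty_iff_eq_empty] at h
    exact hsep (by simp [h])

theorem Admissible.exists_carve (hD : D.Admissible k) (hχ : D.ValidChoices γ k χ)
    (T : Finset (Fin r)) (S : Finset V) :
    ∃ 𝒮 Z, D.Carve γ k χ T S 𝒮 Z ∧ ∀ A ∈ 𝒮, A.card < S.card := by
  classical
  induction hn : S.card using Nat.strong_induction_on generalizing S with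
  | _ n ih =>
    subst hn
    rcases (D.active γ k T S).eq_empty_or_nonempty with h | h
    · exact ⟨[], ∅, .done S h, by simp⟩
    · obtain ⟨h1, h2⟩ := hD.nextRegion_card_lt hχ h
      obtain ⟨𝒮, Z, hC, hA⟩ := ih _ h2 _ rfl
      refine ⟨_, _, .step S 𝒮 Z h hC, fun A hmem => ?_⟩
      rcases List.mem_cons.1 hmem with rfl | hmem
      exacts [h1, (hA A hmem).trans h2]

theorem Admissible.exists_returns (hD : D.Admissible k) (hχ : D.ValidChoices γ k χ)
    (U : Finset V) (T : Finset (Fin r)) : ∃ Z, D.Returns γ k χ U T Z := by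
  classical
  induction hn : U.card using Nat.strong_induction_on generalizing U T with
  | _ n ih =>
    subst hn
    obtain ⟨𝒮, Z, hC, hlt⟩ := hD.exists_carve hχ T U
    have key : ∀ A, ∃ Z', A ∈ 𝒮 → D.Returns γ k χ A (D.pairsIn T A) Z' := fun A => by
      by_cases hA : A ∈ 𝒮
      · obtain ⟨Z', hZ'⟩ := ih _ (hlt A hA) A (D.pairsIn T A) rfl
        exact ⟨Z', fun _ => hZ'⟩
      · exact ⟨∅, fun h => absurd h hA⟩
    choose R hR using key
    exact ⟨_, .call U T 𝒮 Z R hC hR⟩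

theorem Admissible.exists_validChoices (hD : D.Admissible k) (hr : 1 ≤ r) (hk : 2 ≤ k)
    (hγ : 1 < γ) : ∃ χ, D.ValidChoices γ k χ := by
  classical
  have h1 : ∀ T S, ∃ i : Fin r, (D.active γ k T S).Nonempty → i ∈ D.active γ k T S := fun T S => by
    by_cases h : (D.active γ k T S).Nonempty
    · exact ⟨h.choose, fun _ => h.choose_spec⟩
    · exact ⟨⟨0, hr⟩, fun h' => absurd h' h⟩
  have h2 : ∀ S i, ∃ ρ, i ∈ D.active γ k Finset.univ S → D.GoodRadius γ S i ρ := fun S i => by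
    by_cases h : i ∈ D.active γ k Finset.univ S
    · obtain ⟨⟨-, hs, -⟩, hc⟩ := mem_active.1 h
      obtain ⟨ρ, hρ⟩ := hD.exists_goodRadius hr hk hγ hs hc
      exact ⟨ρ, fun _ => hρ⟩
    · exact ⟨0, fun h' => absurd h' h⟩
  choose p hp using h1
  choose ρ hρ using h2
  exact ⟨⟨p, ρ⟩, hp, fun S i hi => hρ S i hi⟩

/-- A well-connected pair that survives the loop lies in one of the carved regions. -/
theorem Admissible.exists_region_of_carve (hD : D.Admissible k) (hχ : D.ValidChoices γ k χ)
    {𝒮 : List (Finset V)} {Z : Finset E}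
    (hC : D.Carve γ k χ T S 𝒮 Z) {Q : Set E} (hQ : ∀ e ∈ Q, e ∉ Z) {i : Fin r} (hi : i ∈ T)
    (hs : D.s i ∈ S) {m : ℕ} (hm : 0 < m) (hq : γ * ((k : ℝ) - 1) ≤ m)
    (hP : D.graph.HasDisjointPaths (D.graph.inside S ∩ Q) (D.s i) (D.t i) m) :
    ∃ A ∈ 𝒮, D.s i ∈ A ∧ D.t i ∈ A ∧
      D.graph.HasDisjointPaths (D.graph.inside A ∩ Q) (D.s i) (D.t i) m := by
  classical
  induction hC with
  | done S h =>
    have ht := (hP.inside_of_closed hs hm fun e he a _ b hj =>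
      ((MultiGraph.mem_inside_iff_of_joins hj S).1 he.1).2).1
    -- The surviving paths keep the pair active, but the loop ends only when no pair is.
    have hmem : i ∈ D.active γ k T S := by
      obtain ⟨P, hP, hd⟩ := hP
      exact mem_active.2 ⟨⟨hi, hs, ht⟩, m, hq, P,
        fun j => ⟨(hP j).1, fun e he => ((hP j).2 e he).1⟩, hd⟩
    simp [h] at hmem
  | step S 𝒮 Z h next ih =>
    set A := D.nextRegion χ T S with hA
    have hAS : A ⊆ S := (hD.nextRegion_spec hχ h).1
    -- The boundary of `A` was put into the collected set, so paths in `Q` stay on the side of `A`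
    -- on which they start.
    have hb : ∀ e ∈ D.graph.inside S ∩ Q, ∀ a ∈ A, ∀ b ∉ A, ¬ D.graph.Joins e a b :=
      fun e he a ha b hb hj => hQ e he.2 (Finset.mem_union_left _ (MultiGraph.mem_boundary.2
        ⟨a, ha, b, ((MultiGraph.mem_inside_iff_of_joins hj S).1 he.1).2, hb, hj⟩))
    by_cases hsA : D.s i ∈ A
    · obtain ⟨ht, hP'⟩ := hP.inside_of_closed hsA hm fun e he a ha b hj => by
        by_contra hbA
        exact hb e he a ha b hbA hj
      exact ⟨A, List.mem_cons_self, hsA, ht, hP'⟩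
    · have hsR : D.s i ∈ S \ A := Finset.mem_sdiff.2 ⟨hs, hsA⟩
      obtain ⟨ht, hP'⟩ := hP.inside_of_closed hsR hm fun e he a ha b hj => by
        refine Finset.mem_sdiff.2 ⟨((MultiGraph.mem_inside_iff_of_joins hj S).1 he.1).2, fun hbA => ?_⟩
        exact hb e he b hbA a (Finset.mem_sdiff.1 ha).2 hj.symm
      obtain ⟨B, hB, H⟩ := ih (fun e he hZ => hQ e he (Finset.mem_union_right _ hZ)) hsR hP'
      exact ⟨B, List.mem_cons_of_mem _ hB, H⟩

/-- The returned set disconnects all pairs of the call to the required degree. -/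
theorem Admissible.not_hasDisjointPaths_of_returns (hD : D.Admissible k)
    (hχ : D.ValidChoices γ k χ) {U : Finset V} {Z : Finset E} (hR : D.Returns γ k χ U T Z)
    {Q : Set E} (hQ : ∀ e ∈ Q, e ∉ Z) {i : Fin r} (hi : i ∈ T) (hs : D.s i ∈ U) {m : ℕ}
    (hm : 0 < m) (hq : γ * ((k : ℝ) - 1) ≤ m) :
    ¬ D.graph.HasDisjointPaths (D.graph.inside U ∩ Q) (D.s i) (D.t i) m := by
  classical
  induction hR with
  | call U T 𝒮 Z R loop recurse ih =>
    intro hP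
    obtain ⟨A, hA, hsA, htA, hPA⟩ := hD.exists_region_of_carve hχ loop
      (fun e he hZ => hQ e he (Finset.mem_union_left _ hZ)) hi hs hm hq hP
    refine ih A hA (fun e he hZ => hQ e he (Finset.mem_union_right _ ?_))
      (mem_pairsIn.2 ⟨hi, hsA, htA⟩) hsA hPA
    exact Finset.mem_biUnion.2 ⟨A, List.mem_toFinset.2 hA, hZ⟩

variable (D) in
/-- The bound, up to the factor `K L`, on the cost of a call whose node set is `S` and which has to
separate `n` out of its `N` pairs. -/
def costBound (S : Finset V) (N n : ℕ) : ℝ :=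
  D.weight S * (Nat.log 2 (2 * N) + Real.log ((D.β + D.weight S) / D.β)) +
    D.β * n * Real.log (Real.exp 1 * (r + 1))

theorem Admissible.costBound_nonneg (hD : D.Admissible k) (S : Finset V) (N n : ℕ) :
    0 ≤ D.costBound S N n := by
  have hw := hD.weight_nonneg S
  have hβ := hD.β_nonneg
  have h1 : 0 ≤ Real.log ((D.β + D.weight S) / D.β) := by
    rcases hβ.eq_or_lt with h | h
    · simp [← h]
    · exact Real.log_nonneg ((one_le_div h).2 (by linarith))
  have h2 : 0 ≤ Real.log (Real.exp 1 * (r + 1)) := by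
    refine Real.log_nonneg ?_
    nlinarith [Real.one_le_exp zero_le_one, (Nat.cast_nonneg r : (0 : ℝ) ≤ r)]
  unfold costBound
  positivity

/-- Along the loop `T` stays fixed while the number of pairs still inside the current set drops.
Each step pays for its cut and for the budget of the recursive call on its region. -/
theorem Admissible.carve_cost_le (hD : D.Admissible k) (hr : 1 ≤ r) (hk : 2 ≤ k) (hγ : 1 < γ)
    (hχ : D.ValidChoices γ k χ) {𝒮 : List (Finset V)} {Z : Finset E}
    (hC : D.Carve γ k χ T S 𝒮 Z) {P : ℝ}
    (hP : P = 2 * γ / (√γ - 1) ^ 2 * Real.log (Real.log (Real.exp 1 * (r + 1)))) :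
    (Z.card : ℝ) + (𝒮.map fun A =>
        P * D.costBound A (D.pairsIn T A).card (D.pairsIn T A).card).sum ≤
      P * D.costBound S T.card (D.pairsIn T S).card := by
  classical
  have hP0 : 0 ≤ P := by
    rw [hP]
    have := log_log_exp_mul_pos hr
    positivity
  induction hC with
  | done S h => simpa using mul_nonneg hP0 (hD.costBound_nonneg S _ _)
  | step S 𝒮 Z h next ih =>
    obtain ⟨hAS, ⟨i, hi, hsep⟩, hhalf, W, hW, hW', hcut⟩ := hD.nextRegion_spec hχ h
    set A := D.nextRegion χ T S with hA
    obtain ⟨j, hj⟩ := h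
    obtain ⟨⟨-, hjs, -⟩, hjc⟩ := mem_active.1 hj
    have hβ := hD.β_pos hr hk hγ hjs hjc
    have hT : 0 < T.card := Finset.card_pos.2 ⟨i, (mem_pairsIn.1 hi).1⟩
    rw [← hP] at hcut
    have hstep := region_cost_le (nA := (D.pairsIn T A).card) hP0 hβ (hD.weight_nonneg A)
      (hD.weight_nonneg (S \ A)) (hD.weight_add_weight_sdiff_le hAS) hW hW' rfl
      (hD.xVolume_le hr S) (g := Nat.log 2 (2 * T.card))
      (gA := Nat.log 2 (2 * (D.pairsIn T A).card))
      (by exact_mod_cast Nat.log_two_mul_succ_le hhalf hT) (Nat.cast_nonneg _) hcut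
    have hpairs : (1 : ℝ) + (D.pairsIn T A).card + (D.pairsIn T (S \ A)).card ≤
        (D.pairsIn T S).card := by exact_mod_cast card_pairsIn_add_lt hAS hi hsep
    have hunion : ((D.graph.boundary S A ∪ Z).card : ℝ) ≤
        (D.graph.boundary S A).card + Z.card := by exact_mod_cast Finset.card_union_le _ _
    have hc : 0 ≤ Real.log (Real.exp 1 * ((r : ℝ) + 1)) := by
      refine Real.log_nonneg ?_
      nlinarith [Real.one_le_exp zero_le_one, (Nat.cast_nonneg r : (0 : ℝ) ≤ r)]
    have hlog : Real.log ((D.β + D.weight (S \ A)) / D.β) ≤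
        Real.log ((D.β + D.weight S) / D.β) := by
      have := hD.weight_nonneg (S \ A)
      have := hD.weight_mono (Finset.sdiff_subset (s := S) (t := A))
      exact Real.log_le_log (by positivity) (by gcongr)
    -- Raising the logarithm for the rest to that of `S` gives the two weight shares, that of `S \
    -- A` and what `S` loses, the same factor, so they add up to the weight of `S`.
    have hrest : D.costBound (S \ A) T.card (D.pairsIn T (S \ A)).card ≤
        D.weight (S \ A) * (Nat.log 2 (2 * T.card) + Real.log ((D.β + D.weight S) / D.β)) +
          D.β * (D.pairsIn T (S \ A)).card * Real.log (Real.exp 1 * (r + 1)) := by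
      have := hD.weight_nonneg (S \ A)
      unfold costBound
      gcongr
    rw [List.map_cons, List.sum_cons]
    calc _ ≤ ((D.graph.boundary S A).card : ℝ) +
          P * D.costBound A (D.pairsIn T A).card (D.pairsIn T A).card +
          P * D.costBound (S \ A) T.card (D.pairsIn T (S \ A)).card := by linarith
      _ ≤ P * ((D.weight S - D.weight (S \ A)) * (Nat.log 2 (2 * T.card) +
            Real.log ((D.β + D.weight S) / D.β)) +
            D.β * (1 + (D.pairsIn T A).card) * Real.log (Real.exp 1 * (r + 1))) +
          P * (D.weight (S \ A) * (Nat.log 2 (2 * T.card) +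
            Real.log ((D.β + D.weight S) / D.β)) +
            D.β * (D.pairsIn T (S \ A)).card * Real.log (Real.exp 1 * (r + 1))) :=
          add_le_add hstep (by gcongr)
      _ = P * (D.weight S * (Nat.log 2 (2 * T.card) + Real.log ((D.β + D.weight S) / D.β)) +
            D.β * (1 + (D.pairsIn T A).card + (D.pairsIn T (S \ A)).card) *
              Real.log (Real.exp 1 * (r + 1))) := by ring
      _ ≤ _ := by
        unfold costBound
        gcongr

theorem Admissible.returns_cost_le (hD : D.Admissible k) (hr : 1 ≤ r) (hk : 2 ≤ k) (hγ : 1 < γ)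
    (hχ : D.ValidChoices γ k χ) {U : Finset V} {Z : Finset E} (hR : D.Returns γ k χ U T Z) {P : ℝ}
    (hP : P = 2 * γ / (√γ - 1) ^ 2 * Real.log (Real.log (Real.exp 1 * (r + 1)))) :
    (Z.card : ℝ) ≤ P * D.costBound U T.card T.card := by
  classical
  have hP0 : 0 ≤ P := by
    rw [hP]
    have := log_log_exp_mul_pos hr
    positivity
  induction hR with
  | call U T 𝒮 Z R loop recurse ih =>
    have h1 := hD.carve_cost_le hr hk hγ hχ loop hP
    have h2 : ((𝒮.toFinset.biUnion R).card : ℝ) ≤ (𝒮.map fun A =>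
        P * D.costBound A (D.pairsIn T A).card (D.pairsIn T A).card).sum := by
      clear h1 loop recurse
      induction 𝒮 with
      | nil => simp
      | cons A 𝒮 ih' =>
        rw [List.toFinset_cons, Finset.biUnion_insert, List.map_cons, List.sum_cons]
        have h3 : ((R A ∪ 𝒮.toFinset.biUnion R).card : ℝ) ≤
          (R A).card + (𝒮.toFinset.biUnion R).card := by exact_mod_cast Finset.card_union_le _ _
        exact h3.trans (add_le_add (ih A List.mem_cons_self)
          (ih' fun B hB => ih B (List.mem_cons_of_mem _ hB)))
    have h3 : ((Z ∪ 𝒮.toFinset.biUnion R).card : ℝ) ≤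
      Z.card + (𝒮.toFinset.biUnion R).card := by exact_mod_cast Finset.card_union_le _ _
    have h4 : D.costBound U T.card (D.pairsIn T U).card ≤ D.costBound U T.card T.card := by
      have h5 : (D.pairsIn T U).card ≤ T.card :=
        Finset.card_le_card fun j hj => (mem_pairsIn.1 hj).1
      have hc : 0 ≤ Real.log (Real.exp 1 * ((r : ℝ) + 1)) := by
        refine Real.log_nonneg ?_
        nlinarith [Real.one_le_exp zero_le_one, (Nat.cast_nonneg r : (0 : ℝ) ≤ r)]
      have := hD.β_nonneg
      unfold costBound
      gcongr
    have h5 : P * D.costBound U T.card (D.pairsIn T U).card ≤ P * D.costBound U T.card T.card := by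
      gcongr
    linarith

end RoundingData

/-! ### Passing to the subdivided graph -/

namespace MultiGraph

variable {V E : Type*} {G : MultiGraph V E} {r : ℕ}

theorem subNode_zero (e : E) : G.subNode r e 0 = Sum.inl (G.left e) := rfl

theorem subNode_last (e : E) : G.subNode r e (r + 1) = Sum.inl (G.right e) := by
  simp [subNode]

theorem joins_subdivide (e : E) (m : Fin (r + 1)) :
    (G.subdivide r).Joins (e, m) (G.subNode r e m) (G.subNode r e (m + 1)) :=
  joins_left_right _ _

/-- Prolong a walk of the subdivided graph that starts at the right end of `e` along the path that
replaces `e`. -/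
theorem exists_walk_of_right (e : E) {w : V ⊕ (E × Fin r)}
    (q : (G.subdivide r).Walk (Sum.inl (G.right e)) w) (n : ℕ) (hn : n ≤ r + 1) :
    ∃ q' : (G.subdivide r).Walk (G.subNode r e (r + 1 - n)) w,
      ∀ f ∈ q'.edges, f.1 = e ∨ f ∈ q.edges := by
  induction n with
  | zero =>
    rw [Nat.sub_zero, subNode_last]
    exact ⟨q, fun f hf => Or.inr hf⟩
  | succ n ih =>
    obtain ⟨q', hq'⟩ := ih (by omega)
    have hj := joins_subdivide (G := G) e (⟨r + 1 - (n + 1), by omega⟩ : Fin (r + 1))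
    have heq : r + 1 - (n + 1) + 1 = r + 1 - n := by omega
    simp only [heq] at hj
    refine ⟨.cons _ hj q', fun f hf => ?_⟩
    rcases List.mem_cons.1 hf with rfl | hf
    exacts [Or.inl rfl, hq' f hf]

/-- Prolong a walk of the subdivided graph that starts at the left end of `e` along the path that
replaces `e`. -/
theorem exists_walk_of_left (e : E) {w : V ⊕ (E × Fin r)}
    (q : (G.subdivide r).Walk (Sum.inl (G.left e)) w) (n : ℕ) (hn : n ≤ r + 1) :
    ∃ q' : (G.subdivide r).Walk (G.subNode r e n) w, ∀ f ∈ q'.edges, f.1 = e ∨ f ∈ q.edges := by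
  induction n with
  | zero => exact ⟨q, fun f hf => Or.inr hf⟩
  | succ n ih =>
    obtain ⟨q', hq'⟩ := ih (by omega)
    have hj := joins_subdivide (G := G) e (⟨n, by omega⟩ : Fin (r + 1))
    refine ⟨.cons _ hj.symm q', fun f hf => ?_⟩
    rcases List.mem_cons.1 hf with rfl | hf
    exacts [Or.inl rfl, hq' f hf]

theorem Walk.exists_subdivide {u v : V} (p : G.Walk u v) :
    ∃ q : (G.subdivide r).Walk (Sum.inl u) (Sum.inl v), ∀ f ∈ q.edges, f.1 ∈ p.edges := by
  induction p with
  | nil u => exact ⟨.nil _, by simp [Walk.edges]⟩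
  | @cons a b c e h p ih =>
    obtain ⟨q, hq⟩ := ih
    have key : ∃ q' : (G.subdivide r).Walk (Sum.inl a) (Sum.inl c),
        ∀ f ∈ q'.edges, f.1 = e ∨ f ∈ q.edges := by
      rcases h with ⟨rfl, rfl⟩ | ⟨rfl, rfl⟩
      · have := exists_walk_of_right e q (r + 1) le_rfl
        rwa [Nat.sub_self, subNode_zero] at this
      · have := exists_walk_of_left e q (r + 1) le_rfl
        rwa [subNode_last] at this
    obtain ⟨q', hq'⟩ := key
    refine ⟨q', fun f hf => ?_⟩
    rcases hq' f hf with h | h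
    · exact h ▸ List.mem_cons_self
    · exact List.mem_cons_of_mem _ (hq f h)

/-- Edge-disjoint paths can be lifted to the subdivided graph. -/
theorem HasDisjointPaths.subdivide {F : Set E} {u v : V} {m : ℕ} (h : G.HasDisjointPaths F u v m) :
    (G.subdivide r).HasDisjointPaths {f | f.1 ∈ F} (Sum.inl u) (Sum.inl v) m := by
  obtain ⟨P, hP, hd⟩ := h
  have key : ∀ j, ∃ q : (G.subdivide r).Walk (Sum.inl u) (Sum.inl v), q.IsPath ∧
      ∀ f ∈ q.edges, f.1 ∈ (P j).edges := fun j => by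
    obtain ⟨q, hq⟩ := (P j).exists_subdivide (r := r)
    obtain ⟨q', h1, h2⟩ := q.exists_isPath
    exact ⟨q', h1, fun f hf => hq f (h2.subset hf)⟩
  choose q hq hq' using key
  exact ⟨q, fun j => ⟨hq j, fun f hf => (hP j).2 _ (hq' j f hf)⟩,
    fun j j' hne f hf hf' => hd j j' hne (hq' j f hf) (hq' j' f hf')⟩

/-- If every path from `u` to `v` has length at least `1`, then some potential that grows along each
edge by at most its length separates `u` and `v`. -/
theorem exists_potential {l : E → ℝ} (hl : ∀ e, 0 ≤ l e) {u v : V}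
    (h : ∀ p : G.Walk u v, p.IsPath → 1 ≤ p.length l) :
    ∃ d : V → ℝ, d u = 0 ∧ d v = 1 ∧ ∀ e a b, G.Joins e a b → d b - d a ≤ l e := by
  have h1 : 1 ≤ G.pathDist l u v := le_iInf fun p => by
    obtain ⟨q, hq, hs⟩ := p.exists_isPath
    rw [ENNReal.one_le_ofReal]
    refine (h q hq).trans ((hs.map l).sum_le_sum ?_)
    simpa using fun e _ => hl e
  -- Truncating at 1 keeps the potential finite at unreachable vertices and makes it exactly 1 at
  -- `v`.
  refine ⟨fun a => (min 1 (G.pathDist l u a)).toReal, by simp [pathDist_self], by simp [h1],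
    fun e a b hj => ?_⟩
  have h2 : min 1 (G.pathDist l u b) ≤ min 1 (G.pathDist l u a) + ENNReal.ofReal (l e) := by
    rw [min_add]
    refine le_min (min_le_of_left_le le_self_add) (min_le_of_right_le ?_)
    exact (pathDist_triangle hl u a b).trans (by gcongr; exact pathDist_le_of_joins l hj)
  have ht : ∀ c : ℝ≥0∞, min 1 c ≠ ⊤ := fun c =>
    ne_top_of_le_ne_top ENNReal.one_ne_top (min_le_left _ _)
  have h3 := ENNReal.toReal_mono (ENNReal.add_ne_top.2 ⟨ht _, ENNReal.ofReal_ne_top⟩) h2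
  rw [ENNReal.toReal_add (ht _) ENNReal.ofReal_ne_top, ENNReal.toReal_ofReal (hl e)] at h3
  linarith

end MultiGraph

namespace MulticutInstance

variable {V E : Type*} [Fintype E] {r k : ℕ} {I : MulticutInstance V E r} {x : E → ℝ}
  {y : Fin r → E → ℝ}

/-- The part of the length of `e`, for commodity `i`, on its first `m` pieces. -/
def prefixLength (x : E → ℝ) (y : Fin r → E → ℝ) (i : Fin r) (e : E) (m : ℕ) : ℝ :=
  (if 0 < m then x e else 0) + if (i : ℕ) + 1 < m then y i e else 0

theorem prefixLength_succ (i : Fin r) (e : E) (m : Fin (r + 1)) :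
    prefixLength x y i e (m + 1) = prefixLength x y i e m +
      ((I.subdivide x y).x (e, m) + (I.subdivide x y).y i (e, m)) := by
  have h1 : m = 0 ↔ (m : ℕ) = 0 := Fin.ext_iff
  have h2 : m = i.succ ↔ (m : ℕ) = i + 1 := by rw [Fin.ext_iff, Fin.val_succ]
  simp only [prefixLength, subdivide, h1, h2]
  split_ifs <;> first | omega | ring

/-- A potential for the original graph extends to the subdivision: an inner node gets the cheaper of
its values reached from the two ends of its edge. This avoids projecting walks back. -/
theorem LPFeasible.one_le_dist (h : I.LPFeasible k x y) (i : Fin r) :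
    1 ≤ (I.subdivide x y).dist i (Sum.inl (I.s i)) (Sum.inl (I.t i)) := by
  obtain ⟨hpath, -, hx, hy⟩ := h
  obtain ⟨d, hs, ht, hd⟩ := MultiGraph.exists_potential (fun e => add_nonneg (hx e) (hy i e))
    (hpath i)
  set pot : V ⊕ (E × Fin r) → ℝ := Sum.elim d fun f =>
    min (d (I.graph.left f.1) + prefixLength x y i f.1 (f.2 + 1))
      (d (I.graph.right f.1) + (x f.1 + y i f.1 - prefixLength x y i f.1 (f.2 + 1))) with hpot
  -- The formula also holds at the original ends m = 0 and m = r + 1, where the minimum is the end's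
  -- own value since `d` changes along `e` by at most its length.
  have hnode : ∀ e, ∀ m ≤ r + 1, pot (I.graph.subNode r e m) =
      min (d (I.graph.left e) + prefixLength x y i e m)
        (d (I.graph.right e) + (x e + y i e - prefixLength x y i e m)) := fun e m hm => by
    have hLR := hd e _ _ (I.graph.joins_left_right e)
    have hRL := hd e _ _ (I.graph.joins_left_right e).symm
    rcases Nat.eq_zero_or_pos m with rfl | hm0
    · rw [MultiGraph.subNode_zero, min_eq_left] <;> simp [prefixLength, hpot]
      linarith
    rcases hm.lt_or_eq with hlt | rfl
    · have h1 : I.graph.subNode r e m = Sum.inr (e, ⟨m - 1, by omega⟩) := by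
        rw [MultiGraph.subNode, if_neg (by omega), dif_pos (by omega)]
      have h2 : m - 1 + 1 = m := by omega
      rw [h1]
      simp [hpot, h2]
    · rw [MultiGraph.subNode_last, min_eq_right] <;> simp [prefixLength, hpot]
      linarith
  refine le_iInf fun p => ?_
  rw [ENNReal.one_le_ofReal]
  have key := p.sub_le_length (l := fun f => (I.subdivide x y).x f + (I.subdivide x y).y i f)
    (f := pot) ?_
  · simpa [hpot, hs, ht] using key
  · rintro ⟨e, m⟩ a b hj
    have hstep := prefixLength_succ (I := I) (x := x) (y := y) i e m
    have hnn : 0 ≤ (I.subdivide x y).x (e, m) + (I.subdivide x y).y i (e, m) := by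
      simp only [subdivide]
      split_ifs <;> simp [hx, hy, add_nonneg]
    have n1 := hnode e m m.2.le
    have n2 := hnode e (m + 1) (by omega)
    rw [hstep] at n2
    generalize (I.subdivide x y).x (e, m) + (I.subdivide x y).y i (e, m) = c at *
    rcases hj with ⟨rfl, rfl⟩ | ⟨rfl, rfl⟩
    · change pot (I.graph.subNode r e (m + 1)) - pot (I.graph.subNode r e m) ≤ c
      rw [n1, n2]
      grind
    · change pot (I.graph.subNode r e m) - pot (I.graph.subNode r e (m + 1)) ≤ c
      rw [n1, n2]
      grind

theorem opt_subdivide : (I.subdivide x y).opt = ∑ e, x e := by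
  classical
  simp [RoundingData.opt, subdivide, Fintype.sum_prod_type]

theorem LPFeasible.admissible (h : I.LPFeasible k x y) : (I.subdivide x y).Admissible k where
  x_nonneg f := by
    simp only [subdivide]
    split_ifs <;> simp [h.2.2.1]
  y_nonneg i f := by
    simp only [subdivide]
    split_ifs <;> simp [h.2.2.2]
  x_eq_zero f hf := by
    have : f.2 ≠ 0 := by simpa [subdivide] using hf
    simp [subdivide, this]
  y_eq_zero i f hf := by
    have : f.2 = 0 := by simpa [subdivide] using hf
    simp [subdivide, this, (Fin.succ_ne_zero i).symm]
  sum_y_le i := by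
    classical
    simpa [subdivide, Fintype.sum_prod_type] using h.2.1 i
  one_le_dist := h.one_le_dist

end MulticutInstance

/-! ### Numerical constants -/

section LogFactor

open Real

theorem log_log_mul_le_logFactor : ∃ C : ℝ, 0 < C ∧ ∀ r : ℕ, 1 ≤ r →
    log (log (exp 1 * (r + 1))) * (Nat.log 2 (2 * r) + 1 + 2 * log (r + 1)) ≤ C * logFactor r := by
  set f : ℕ → ℝ := fun r =>
    log (log (exp 1 * (r + 1))) * (Nat.log 2 (2 * r) + 1 + 2 * log (r + 1)) with hf
  have hf0 : ∀ r, 1 ≤ r → 0 ≤ f r := fun r hr => by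
    have h1 := log_log_exp_mul_pos hr
    have h2 : (0 : ℝ) ≤ log (r + 1) := log_nonneg (by simp)
    rw [hf]
    positivity
  have h3 : 1 < log 3 := by
    rw [lt_log_iff_exp_lt (by norm_num)]
    exact exp_one_lt_three
  have hc : 0 < log (log 3) := log_pos h3
  -- The first two terms cover r ≤ 2. For r ≥ 3 and u = ln r > 1, the second factor is at most 4u +
  -- u + 4u, and the double logarithm is at most ln(3u) = ln 3 + ln u, with ln 3 absorbed through ln
  -- u ≥ ln ln 3.
  refine ⟨f 1 + f 2 + 9 * (log 3 / log (log 3) + 1), ?_, fun r hr => ?_⟩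
  · have := hf0 1 le_rfl
    have := hf0 2 (by norm_num)
    positivity
  have hf1 := hf0 1 le_rfl
  have hf2 := hf0 2 (by norm_num)
  have hq : 0 < log 3 / log (log 3) := by positivity
  change f r ≤ _
  unfold logFactor
  split_ifs with hr2
  · rw [mul_one]
    obtain rfl | rfl : r = 1 ∨ r = 2 := by omega
    all_goals linarith
  have hr3 : (3 : ℝ) ≤ r := by exact_mod_cast (by omega : 3 ≤ r)
  set u := log r with hu
  have hu3 : log 3 ≤ u := log_le_log (by norm_num) hr3
  have hlu : log (log 3) ≤ log u := log_le_log (by linarith) hu3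
  have hsq : log ((r : ℝ) ^ 2) = 2 * u := by rw [log_pow, hu]; norm_num
  have e1 : log (r + 1) ≤ 2 * u := by
    rw [← hsq]
    exact log_le_log (by positivity) (by nlinarith)
  have e2 : (Nat.log 2 (2 * r) : ℝ) ≤ 4 * u := by
    have h1 : (2 : ℝ) ^ Nat.log 2 (2 * r) ≤ 2 * r := by
      exact_mod_cast Nat.pow_log_le_self 2 (by omega : 2 * r ≠ 0)
    have h2 := log_le_log (by positivity) (h1.trans (by nlinarith : (2 : ℝ) * r ≤ r ^ 2))
    rw [hsq, log_pow] at h2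
    nlinarith [log_two_gt_d9, (Nat.cast_nonneg (Nat.log 2 (2 * r)) : (0 : ℝ) ≤ _)]
  have e3 : log (log (exp 1 * (r + 1))) ≤ (log 3 / log (log 3) + 1) * log u := by
    rw [log_mul (exp_ne_zero 1) (by positivity), log_exp]
    calc log (1 + log (r + 1)) ≤ log (3 * u) := by
          refine log_le_log ?_ (by linarith)
          have : (0 : ℝ) ≤ log (r + 1) := log_nonneg (by linarith)
          linarith
      _ = log 3 + log u := log_mul (by norm_num) (by linarith)
      _ = log 3 / log (log 3) * log (log 3) + log u := by field_simp
      _ ≤ log 3 / log (log 3) * log u + log u := by gcongr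
      _ = _ := by ring
  have hlu0 : 0 < log u := hc.trans_le hlu
  have hu0 : 0 < u := by linarith
  have e4 : (Nat.log 2 (2 * r) : ℝ) + 1 + 2 * log (r + 1) ≤ 9 * u := by linarith
  have e5 : (0 : ℝ) ≤ Nat.log 2 (2 * r) + 1 + 2 * log (r + 1) := by
    have : (0 : ℝ) ≤ log (r + 1) := log_nonneg (by linarith)
    positivity
  calc f r ≤ (log 3 / log (log 3) + 1) * log u * (9 * u) :=
        mul_le_mul e3 e4 e5 (by positivity)
    _ = 9 * (log 3 / log (log 3) + 1) * (u * log u) := by ring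
    _ ≤ _ := by
      gcongr
      linarith

/-- The factor that depends on `γ`, for `γ = k / (k - 1)`. -/
theorem div_sqrt_sub_one_sq_le {k : ℕ} (hk : 2 ≤ k) :
    (k : ℝ) / ((k : ℝ) - 1) / (√((k : ℝ) / ((k : ℝ) - 1)) - 1) ^ 2 ≤ 18 * ((k : ℝ) - 1) ^ 2 := by
  have hk2 : (2 : ℝ) ≤ k := by exact_mod_cast hk
  have hk1 : (0 : ℝ) < (k : ℝ) - 1 := by linarith
  set γ : ℝ := (k : ℝ) / ((k : ℝ) - 1) with hγ
  have h1 : γ - 1 = 1 / ((k : ℝ) - 1) := by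
    rw [hγ]
    field_simp
    ring
  have hγ1 : 1 < γ := by
    have : 0 < γ - 1 := by
      rw [h1]
      positivity
    linarith
  have hγ2 : γ ≤ 2 := by
    rw [hγ, div_le_iff₀ hk1]
    linarith
  have hs : √γ * √γ = γ := mul_self_sqrt (by linarith)
  have hs1 : 1 < √γ := lt_sqrt_of_sq_lt (by simpa using hγ1)
  have hs2 : √γ ≤ 2 := by nlinarith
  have h2 : (√γ - 1) * (√γ + 1) * ((k : ℝ) - 1) = 1 := by
    have : (√γ - 1) * (√γ + 1) = γ - 1 := by linarith
    rw [this, h1]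
    field_simp
  have hpos : 0 < √γ - 1 := by linarith
  rw [div_le_iff₀ (by positivity)]
  -- From (√γ-1)(√γ+1) = 1/(k-1) and √γ ≤ 2. Squaring gives 9, and γ ≤ 2 turns it into 18.
  have h3 : 1 ≤ (√γ - 1) * 3 * ((k : ℝ) - 1) := by
    refine h2.symm.le.trans ?_
    gcongr
    linarith
  nlinarith [mul_le_mul h3 h3 zero_le_one (by positivity)]

end LogFactor

/-! ### Guarantees for the original instance -/

namespace MulticutInstance

variable {V E : Type*} [Fintype V] [Fintype E] {r k : ℕ} {I : MulticutInstance V E r} {x : E → ℝ}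
  {y : Fin r → E → ℝ} {γ : ℝ} {χ : Choices (V ⊕ (E × Fin r)) r} {Z : Finset E}

theorem LPFeasible.not_atLeastConnected (h : I.LPFeasible k x y) (hk : 2 ≤ k) (hγ : 1 < γ)
    (hχ : (I.subdivide x y).ValidChoices γ k χ) (hZ : I.AlgReturns k γ x y χ Z) (i : Fin r) :
    ¬ I.graph.AtLeastConnected {e | e ∉ Z} (I.s i) (I.t i) (γ * ((k : ℝ) - 1)) := by
  classical
  rintro ⟨m, hq, hP⟩
  obtain ⟨Z', hR, rfl⟩ := hZ
  have hk2 : (2 : ℝ) ≤ k := by exact_mod_cast hk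
  -- Positivity of γ(k-1) excludes the empty family of paths, which would say nothing about the
  -- position of the sink.
  have hm : 0 < m := by
    have : (0 : ℝ) < m := lt_of_lt_of_le (mul_pos (by linarith) (by linarith)) hq
    exact_mod_cast this
  refine h.admissible.not_hasDisjointPaths_of_returns hχ hR (Q := {f | f ∉ Z'}) (fun e he => he)
    (Finset.mem_univ i) (Finset.mem_univ _) hm hq ?_
  obtain ⟨P, hP, hd⟩ := hP.subdivide (r := r)
  refine ⟨P, fun j => ⟨(hP j).1, fun f hf => ⟨⟨Finset.mem_univ _, Finset.mem_univ _⟩,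
    fun hfZ => ?_⟩⟩, hd⟩
  exact (hP j).2 f hf (by convert Finset.mem_image_of_mem Prod.fst hfZ)

/-- This is the root potential: the weight is at most OPT, the volume ratio at most r + 1, and the r
seeds β together make OPT, which adds 1 + ln(r+1). -/
theorem LPFeasible.card_le (h : I.LPFeasible k x y) (hr : 1 ≤ r) (hk : 2 ≤ k) (hγ : 1 < γ)
    (hχ : (I.subdivide x y).ValidChoices γ k χ) (hZ : I.AlgReturns k γ x y χ Z) :
    (Z.card : ℝ) ≤ 2 * (γ / (√γ - 1) ^ 2) * (Real.log (Real.log (Real.exp 1 * (r + 1))) *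
      (Nat.log 2 (2 * r) + 1 + 2 * Real.log (r + 1))) * ∑ e, x e := by
  classical
  obtain ⟨Z', hR, rfl⟩ := hZ
  have hD := h.admissible
  have hcost := hD.returns_cost_le hr hk hγ hχ hR rfl
  have himg : ((Z'.image Prod.fst).card : ℝ) ≤ Z'.card := by exact_mod_cast Finset.card_image_le
  have hr0 : (0 : ℝ) < r := by exact_mod_cast hr
  set D := I.subdivide x y with hDdef
  have hopt : D.opt = ∑ e, x e := opt_subdivide
  have hβ : D.β * r = D.opt := div_mul_cancel₀ _ hr0.ne'
  have hw := hD.weight_nonneg Finset.univ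
  have hlog : Real.log ((D.β + D.weight Finset.univ) / D.β) ≤ Real.log (r + 1) := by
    rcases hD.β_nonneg.eq_or_lt with h0 | h0
    · rw [← h0, div_zero, Real.log_zero]
      exact Real.log_nonneg (by linarith)
    · refine Real.log_le_log (by positivity) ?_
      rw [div_le_iff₀ h0]
      exact hD.xVolume_le hr Finset.univ
  have hr1 : (0 : ℝ) ≤ Real.log (r + 1) := Real.log_nonneg (by linarith)
  have hbound : D.costBound Finset.univ r r ≤
      D.opt * (Nat.log 2 (2 * r) + 1 + 2 * Real.log (r + 1)) := by
    unfold RoundingData.costBound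
    rw [hβ, Real.log_mul (Real.exp_ne_zero 1) (by positivity), Real.log_exp]
    have h1 : D.weight Finset.univ *
        (Nat.log 2 (2 * r) + Real.log ((D.β + D.weight Finset.univ) / D.β)) ≤
        D.opt * (Nat.log 2 (2 * r) + Real.log (r + 1)) := by
      refine (mul_le_mul_of_nonneg_left (by gcongr) hw).trans
        (mul_le_mul_of_nonneg_right (hD.weight_le_opt _) (by positivity))
    linarith
  rw [Finset.card_univ, Fintype.card_fin] at hcost
  have hL := log_log_exp_mul_pos hr
  refine (le_of_eq (by congr!)).trans (himg.trans (hcost.trans ?_))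
  calc _ ≤ 2 * γ / (√γ - 1) ^ 2 * Real.log (Real.log (Real.exp 1 * (r + 1))) *
        (D.opt * (Nat.log 2 (2 * r) + 1 + 2 * Real.log (r + 1))) := by gcongr
    _ = _ := by
      rw [hopt]
      ring

end MulticutInstance

end

theorem theorem3p7 :
    ∃ C : ℝ, 0 < C ∧
      ∀ (V E : Type*) [Fintype V] [Fintype E] (r k : ℕ) (I : MulticutInstance V E r)
        (x : E → ℝ) (y : Fin r → E → ℝ), 1 ≤ r → 2 ≤ k → I.LPOptimal k x y →
        (∀ γ : ℝ, 1 < γ →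
          (∃ χ, (I.subdivide x y).ValidChoices γ k χ) ∧
          ∀ χ, (I.subdivide x y).ValidChoices γ k χ →
            (∃ Z, I.AlgReturns k γ x y χ Z) ∧
            ∀ Z, I.AlgReturns k γ x y χ Z →
              (∀ i, ¬ I.graph.AtLeastConnected {e | e ∉ Z} (I.s i) (I.t i) (γ * ((k : ℝ) - 1))) ∧
              (Z.card : ℝ) ≤ C * (γ / (√γ - 1) ^ 2 * logFactor r) * ∑ e, x e) ∧
        (∀ χ, (I.subdivide x y).ValidChoices ((k : ℝ) / ((k : ℝ) - 1)) k χ →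
          ∀ Z, I.AlgReturns k ((k : ℝ) / ((k : ℝ) - 1)) x y χ Z →
            I.IsFeasible k Z ∧
            (Z.card : ℝ) ≤ C * (((k : ℝ) - 1) ^ 2 * logFactor r) * ∑ e, x e) := by
  obtain ⟨C, hC, hlog⟩ := log_log_mul_le_logFactor
  -- The 36 is 2 · 18, needed for γ = k/(k-1); for general γ the factor 2 suffices.
  refine ⟨36 * C, by positivity, fun V E _ _ r k I x y hr hk hopt => ?_⟩
  have hfeas := hopt.1
  have hx : 0 ≤ ∑ e, x e := Finset.sum_nonneg fun e _ => hfeas.2.2.1 e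
  have hk2 : (2 : ℝ) ≤ k := by exact_mod_cast hk
  have hk1 : (0 : ℝ) < (k : ℝ) - 1 := by linarith
  have hfac : 0 ≤ C * logFactor r := by
    refine le_trans ?_ (hlog r hr)
    have h1 := log_log_exp_mul_pos hr
    have h2 : (0 : ℝ) ≤ Real.log (r + 1) := Real.log_nonneg (by simp)
    positivity
  have hcard : ∀ γ : ℝ, 1 < γ → ∀ χ, (I.subdivide x y).ValidChoices γ k χ →
      ∀ Z, I.AlgReturns k γ x y χ Z →
        (Z.card : ℝ) ≤ 2 * (γ / (√γ - 1) ^ 2) * (C * logFactor r) * ∑ e, x e :=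
    fun γ hγ χ hχ Z hZ => (hfeas.card_le hr hk hγ hχ hZ).trans (by
      have := hlog r hr
      gcongr)
  refine ⟨fun γ hγ => ⟨hfeas.admissible.exists_validChoices hr hk hγ, fun χ hχ => ⟨?_, fun Z hZ =>
    ⟨hfeas.not_atLeastConnected hk hγ hχ hZ, ?_⟩⟩⟩, fun χ hχ Z hZ => ⟨fun i m hm => ?_, ?_⟩⟩
  · obtain ⟨Z', hZ'⟩ := hfeas.admissible.exists_returns hχ Finset.univ Finset.univ
    exact ⟨_, Z', hZ', rfl⟩
  · refine (hcard γ hγ χ hχ Z hZ).trans ?_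
    have h0 : 0 ≤ γ / (√γ - 1) ^ 2 * (C * logFactor r) * ∑ e, x e := by positivity
    linarith
  -- For this γ the threshold γ(k-1) equals k, so k disjoint paths already contradict the first
  -- part.
  · by_contra! hle
    refine hfeas.not_atLeastConnected hk ?_ hχ hZ i ⟨m, ?_, hm⟩
    · rw [one_lt_div hk1]
      linarith
    · rw [div_mul_cancel₀ _ hk1.ne']
      exact_mod_cast hle
  · refine (hcard _ ?_ χ hχ Z hZ).trans ?_
    · rw [one_lt_div hk1]
      linarith
    · calc _ ≤ 2 * (18 * ((k : ℝ) - 1) ^ 2) * (C * logFactor r) * ∑ e, x e := by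
            gcongr
            exact div_sqrt_sub_one_sq_le hk
        _ = _ := by ring
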